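/- **Setting.** All Lie algebras are over $\mathbb{C}$. Let $A\in\mathbb{Z}^{\ell\times\ell}$. A root basis with structure matrix $A$ consists of a finite-dimensional space $\mathfrak h$ with coroots $h_1,\dots,h_\ell\in\mathfrak h$ and roots $\alpha_1,\dots,\alpha_\ell\in\mathfrak h^*$ with $\alpha_j(h_i)=A_{ij}$. For $\alpha=s\alpha_i$, $s=\pm1$, put $h_\alpha=s\,h_i$. The GIM-Lie algebra of the root basis is the Lie algebra generated by the vector space $\mathfrak h$ and elements $e_{\pm\alpha_i}$ subject to $$[h,h']=0,\quad [h,e_\alpha]=\alpha(h)e_\alpha,\quad [e_\alpha,e_{-\alpha}]=h_\alpha,\quad \mathrm{ad}(e_\alpha)^{\max(1,\,1-\beta(h_\alpha))}(e_\beta)=0\ \ (\alpha\neq-\beta)$$ for all $h,h'\in\mathfrak h$ and all signed roots $\alpha,\beta\in\{\pm\alpha_1,\dots,\pm\alpha_\ell\}$. Its Chevalley generators are $E_i=e_{\alpha_i}$, $F_i=e_{-\alpha_i}$, $H_{\gamma_i}=h_i$. If $A$ is a symmetrisable generalised Cartan matrix and the root basis is a minimal free realisation (roots and coroots linearly independent,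 $\dim\mathfrak h=2\ell-\operatorname{rank}A$), this is the Kac–Moody algebra $\mathfrak g(A)(\mathbb C)$. Let $E_9$ be the affine diagram $E_8^{(1)}$, labelled so that $1,\dots,8$ form a chain and $9$ is joined to $3$. Let $\omega$ be the ($\mathbb C$-linear) Chevalley involution of $\mathfrak g(E_9)(\mathbb C)$, with $\omega(h)=-h$, $\omega(e_i)=-f_i$, $\omega(f_i)=-e_i$. Let $\mathfrak k(E_9)(\mathbb C)$ be its fixed-point subalgebra, and let $x_k=e_k-f_k\in\mathfrak k(E_9)(\mathbb C)$, $k=1,\dots,9$, be the Berman generators. For $a\le b$ put $x_{a..b}=[x_a,[x_{a+1},\dots,[x_{b-1},x_b]\dots]]$. With $i=\sqrt{-1}$ in coefficients, set $H_j=-i\,x_{2j-1}$ for $1\le j\le4$, and for $1\le k<l\le4$ and signs $\varepsilon_1,\varepsilon_2$ $$e_{\varepsilon_1L_k+\varepsilon_2L_l}=\tfrac i2\bigl(x_{2k..2l-1}-i\varepsilon_2x_{2k..2l-2}-i\varepsilon_1x_{2k-1..2l-1}-\varepsilon_1\varepsilon_2x_{2k-1..2l-2}\bigr),\qquad e_{\pm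 L_4}=i\bigl(x_8\mp i[x_7,x_8]\bigr).$$ For $j=1,2,3$ put $$e_j=e_{L_j-L_{j+1}},\quad f_j=e_{-L_j+L_{j+1}},\quad h_j=H_j-H_{j+1},$$ and put $$e_4=e_{L_4},\quad f_4=e_{-L_4},\quad h_4=2H_4,\quad x_\pm=i\bigl(x_9\mp i[x_3,x_9]\bigr).$$ (From here on $e_j,f_j,h_j$ denote these elements of $\mathfrak k(E_9)(\mathbb C)$.) Let $$B_4^\diamond=\begin{pmatrix}2&-2&2&0&0\\-1&2&-1&0&0\\1&-1&2&-1&0\\0&0&-1&2&-1\\0&0&0&-2&2\end{pmatrix}$$ with indices $0,\dots,4$. Take any root basis with structure matrix $B_4^\diamond$, and let $\mathfrak{gim}(B_4^\diamond)(\mathbb C)$ be the subalgebra of its GIM-Lie algebra generated by the Chevalley generators $E_i,F_i,H_{\gamma_i}$, $0\le i\le4$ (the whole GIM-Lie algebra if the coroots span $\mathfrak h$). **Proposition.** There is a surjective homomorphism of Lie algebras $\phi:\mathfrak{gim}(B_4^\diamond)(\mathbb C)\to\mathfrak k(E_9)(\mathbb C)$ with $$\phi(E_0)=x_+,\quad \phi(F_0)=x_-,\quad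 \phi(H_{\gamma_0})=2H_2=2h_2+2h_3+h_4,$$ $$\phi(E_j)=e_j,\quad \phi(F_j)=f_j,\quad \phi(H_{\gamma_j})=h_j\qquad(j=1,2,3,4).$$ It is not injective: the element $$[E_0,[E_0,E_1]]-[E_2,[E_3,[E_4,[E_4,[E_3,[E_2,E_1]]]]]]$$ of $\mathfrak{gim}(B_4^\diamond)(\mathbb C)$ is nonzero and lies in the kernel of $\phi$. -/

import Mathlib

noncomputable section

/-! ### Root bases and GIM-Lie algebras -/

/-- A `ℂ`-root basis `(𝔥, Δ^∨, Δ)` with structure matrix `A`: coroots `h_i ∈ 𝔥` and roots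
`α_i ∈ 𝔥^*` with `α_j (h_i) = A_{ij}`. -/
structure RootBasis {ι : Type*} (A : Matrix ι ι ℤ) (𝔥 : Type*) [AddCommGroup 𝔥] [Module ℂ 𝔥] where
  coroot : ι → 𝔥
  root : ι → Module.Dual ℂ 𝔥
  root_coroot : ∀ i j, root j (coroot i) = (A i j : ℂ)

/-- Generators of the free Lie algebra: `Gen.h x` for `x ∈ 𝔥`, and `Gen.e i s` for the signed root
`s α_i`, `s = ±1`. -/
inductive GIMGen (ι 𝔥 : Type*)
  | h : 𝔥 → GIMGen ι 𝔥
  | e : ι → ℤˣ → GIMGen ι 𝔥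

namespace RootBasis

variable {ι : Type*} {A : Matrix ι ι ℤ} {𝔥 : Type*} [AddCommGroup 𝔥] [Module ℂ 𝔥]

/-- A minimal free realisation of `A`: roots and coroots are linearly independent, and
`dim 𝔥 = 2 n - rank A`, where `n` is the size of `A`. -/
def IsMinimalRealization [Fintype ι] (B : RootBasis A 𝔥) : Prop :=
  FiniteDimensional ℂ 𝔥 ∧ LinearIndependent ℂ B.coroot ∧ LinearIndependent ℂ B.root ∧
    Module.finrank ℂ 𝔥 + (A.map (Int.cast : ℤ → ℂ)).rank = 2 * Fintype.card ι

/-- The free generator belonging to `x ∈ 𝔥`. -/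
def freeH (ι : Type*) (x : 𝔥) : FreeLieAlgebra ℂ (GIMGen ι 𝔥) :=
  FreeLieAlgebra.of ℂ (GIMGen.h x)

/-- The free generator belonging to the signed root `s α_i`. -/
def freeE (𝔥 : Type*) (i : ι) (s : ℤˣ) : FreeLieAlgebra ℂ (GIMGen ι 𝔥) :=
  FreeLieAlgebra.of ℂ (GIMGen.e i s)

/-- The defining relations of the GIM-Lie algebra. The first two say that the generators
`h x` depend linearly on `x ∈ 𝔥`. For signed roots `α = s α_i` and `β = t α_j` one has
`β (h_α) = s t A_{ij}`. -/
inductive Rel (B : RootBasis A 𝔥) :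
    FreeLieAlgebra ℂ (GIMGen ι 𝔥) → FreeLieAlgebra ℂ (GIMGen ι 𝔥) → Prop
  | add (x y : 𝔥) : Rel B (freeH ι (x + y)) (freeH ι x + freeH ι y)
  | smul (c : ℂ) (x : 𝔥) : Rel B (freeH ι (c • x)) (c • freeH ι x)
  | hh (x y : 𝔥) : Rel B ⁅freeH ι x, freeH ι y⁆ 0
  | he (x : 𝔥) (i : ι) (s : ℤˣ) :
      Rel B ⁅freeH ι x, freeE 𝔥 i s⁆ ((((s : ℤ) : ℂ) * B.root i x) • freeE 𝔥 i s)
  | ef (i : ι) (s : ℤˣ) :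
      Rel B ⁅freeE 𝔥 i s, freeE 𝔥 i (-s)⁆ (freeH ι (((s : ℤ) : ℂ) • B.coroot i))
  | serre (i : ι) (s : ℤˣ) (j : ι) (t : ℤˣ) (hne : ¬ (i = j ∧ s = -t)) :
      Rel B (((LieAlgebra.ad ℂ (FreeLieAlgebra ℂ (GIMGen ι 𝔥)) (freeE 𝔥 i s)) ^
        (max 1 (1 - (s : ℤ) * (t : ℤ) * A i j)).toNat) (freeE 𝔥 j t)) 0

/-- The ideal generated by the defining relations. -/
def relIdeal (B : RootBasis A 𝔥) : LieIdeal ℂ (FreeLieAlgebra ℂ (GIMGen ι 𝔥)) :=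
  LieSubmodule.lieSpan ℂ (FreeLieAlgebra ℂ (GIMGen ι 𝔥)) {r | ∃ a b, B.Rel a b ∧ r = a - b}

/-- The GIM-Lie algebra of a root basis. If `A` is a generalised Cartan matrix (all off-diagonal
entries `≤ 0`), then the relations above read `[e_i, f_j] = δ_{ij} h_i`,
`ad(e_i)^(1 - A_{ij}) e_j = 0 = ad(f_i)^(1 - A_{ij}) f_j` for `i ≠ j`, and
`[h, e_i] = α_i(h) e_i`, `[h, f_i] = - α_i(h) f_i`, `[h, h'] = 0`. -/
def GIMAlgebra (B : RootBasis A 𝔥) : Type _ :=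
  FreeLieAlgebra ℂ (GIMGen ι 𝔥) ⧸ B.relIdeal

instance (B : RootBasis A 𝔥) : LieRing B.GIMAlgebra :=
  inferInstanceAs (LieRing (FreeLieAlgebra ℂ (GIMGen ι 𝔥) ⧸ B.relIdeal))

instance (B : RootBasis A 𝔥) : LieAlgebra ℂ B.GIMAlgebra :=
  inferInstanceAs (LieAlgebra ℂ (FreeLieAlgebra ℂ (GIMGen ι 𝔥) ⧸ B.relIdeal))

/-- The quotient map from the free Lie algebra. -/
def proj (B : RootBasis A 𝔥) : FreeLieAlgebra ℂ (GIMGen ι 𝔥) →ₗ⁅ℂ⁆ B.GIMAlgebra where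
  toLinearMap := B.relIdeal.toSubmodule.mkQ
  map_lie' := fun {_ _} => rfl

/-- The image of `x ∈ 𝔥`. -/
def cartan (B : RootBasis A 𝔥) (x : 𝔥) : B.GIMAlgebra := B.proj (freeH ι x)

/-- The element `e_{s α_i}`. -/
def rootGen (B : RootBasis A 𝔥) (i : ι) (s : ℤˣ) : B.GIMAlgebra := B.proj (freeE 𝔥 i s)

theorem proj_eq_of_rel (B : RootBasis A 𝔥) {a b : FreeLieAlgebra ℂ (GIMGen ι 𝔥)}
    (h : B.Rel a b) : B.proj a = B.proj b :=
  (Submodule.Quotient.eq B.relIdeal.toSubmodule).2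
    (LieSubmodule.subset_lieSpan ⟨a, b, h, rfl⟩)

/-- The universal property: a Lie homomorphism on the free Lie algebra that respects the defining
relations descends. -/
def lift (B : RootBasis A 𝔥) {L : Type*} [LieRing L] [LieAlgebra ℂ L]
    (f : FreeLieAlgebra ℂ (GIMGen ι 𝔥) →ₗ⁅ℂ⁆ L) (hf : ∀ a b, B.Rel a b → f a = f b) :
    B.GIMAlgebra →ₗ⁅ℂ⁆ L where
  toLinearMap := B.relIdeal.toSubmodule.liftQ (f : FreeLieAlgebra ℂ (GIMGen ι 𝔥) →ₗ[ℂ] L) (by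
    have h : B.relIdeal ≤ f.ker := by
      refine LieSubmodule.lieSpan_le.2 ?_
      rintro r ⟨a, b, hab, rfl⟩
      simp [hf a b hab]
    intro x hx
    exact (LieHom.mem_ker).1 (h hx))
  map_lie' := fun {x y} => by
    induction x using Submodule.Quotient.induction_on with | _ x
    induction y using Submodule.Quotient.induction_on with | _ y
    exact f.map_lie x y

theorem lift_proj (B : RootBasis A 𝔥) {L : Type*} [LieRing L] [LieAlgebra ℂ L]
    (f : FreeLieAlgebra ℂ (GIMGen ι 𝔥) →ₗ⁅ℂ⁆ L) (hf : ∀ a b, B.Rel a b → f a = f b)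
    (a : FreeLieAlgebra ℂ (GIMGen ι 𝔥)) : B.lift f hf (B.proj a) = f a := rfl

/-- The Chevalley generators `e_{α_i}`, `e_{-α_i}`, `h_{α_i}` generate this subalgebra. It is the
whole algebra if the coroots span `𝔥`. -/
def chevalleySubalgebra (B : RootBasis A 𝔥) : LieSubalgebra ℂ B.GIMAlgebra :=
  LieSubalgebra.lieSpan ℂ B.GIMAlgebra
    (Set.range (fun i => B.rootGen i 1) ∪ Set.range (fun i => B.rootGen i (-1)) ∪
      Set.range (fun i => B.cartan (B.coroot i)))

/-- The Chevalley generator `E_i = e_{α_i}`. -/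
def chevE (B : RootBasis A 𝔥) (i : ι) : B.chevalleySubalgebra :=
  ⟨B.rootGen i 1, LieSubalgebra.subset_lieSpan (Or.inl (Or.inl ⟨i, rfl⟩))⟩

/-- The Chevalley generator `F_i = e_{-α_i}`. -/
def chevF (B : RootBasis A 𝔥) (i : ι) : B.chevalleySubalgebra :=
  ⟨B.rootGen i (-1), LieSubalgebra.subset_lieSpan (Or.inl (Or.inr ⟨i, rfl⟩))⟩

/-- The Chevalley generator `H_i = h_{α_i}`. -/
def chevH (B : RootBasis A 𝔥) (i : ι) : B.chevalleySubalgebra :=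
  ⟨B.cartan (B.coroot i), LieSubalgebra.subset_lieSpan (Or.inr ⟨i, rfl⟩)⟩

/-! ### The Chevalley involution and its fixed points -/

/-- `h ↦ -h`, `e_{± α_i} ↦ - e_{∓ α_i}` on generators. -/
def involutionGen (B : RootBasis A 𝔥) : GIMGen ι 𝔥 → B.GIMAlgebra
  | GIMGen.h x => -B.cartan x
  | GIMGen.e i s => -B.rootGen i (-s)

/-- The Chevalley involution on the free Lie algebra. -/
def involutionFree (B : RootBasis A 𝔥) : FreeLieAlgebra ℂ (GIMGen ι 𝔥) →ₗ⁅ℂ⁆ B.GIMAlgebra :=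
  FreeLieAlgebra.lift ℂ B.involutionGen

theorem involutionFree_freeH (B : RootBasis A 𝔥) (x : 𝔥) :
    B.involutionFree (freeH ι x) = -B.cartan x :=
  FreeLieAlgebra.lift_of_apply B.involutionGen (GIMGen.h x)

theorem involutionFree_freeE (B : RootBasis A 𝔥) (i : ι) (s : ℤˣ) :
    B.involutionFree (freeE 𝔥 i s) = -B.rootGen i (-s) :=
  FreeLieAlgebra.lift_of_apply B.involutionGen (GIMGen.e i s)

theorem map_ad_pow {L L' : Type*} [LieRing L] [LieAlgebra ℂ L] [LieRing L'] [LieAlgebra ℂ L']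
    (f : L →ₗ⁅ℂ⁆ L') (x y : L) (n : ℕ) :
    f (((LieAlgebra.ad ℂ L x) ^ n) y) = ((LieAlgebra.ad ℂ L' (f x)) ^ n) (f y) := by
  induction n with
  | zero => rfl
  | succ n ih => simp only [pow_succ', Module.End.mul_apply, LieAlgebra.ad_apply, LieHom.map_lie, ih]

theorem involutionFree_rel (B : RootBasis A 𝔥) (a b : FreeLieAlgebra ℂ (GIMGen ι 𝔥))
    (h : B.Rel a b) : B.involutionFree a = B.involutionFree b := by
  cases h with
  | add x y =>
    have := B.proj_eq_of_rel (Rel.add x y)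
    rw [map_add, involutionFree_freeH, involutionFree_freeH, involutionFree_freeH, ← neg_add]
    exact congrArg Neg.neg (this.trans (map_add B.proj _ _))
  | smul c x =>
    have := B.proj_eq_of_rel (Rel.smul c x)
    rw [map_smul, involutionFree_freeH, involutionFree_freeH, smul_neg]
    simpa [cartan] using this
  | hh x y =>
    have := B.proj_eq_of_rel (Rel.hh x y)
    rw [LieHom.map_lie, involutionFree_freeH, involutionFree_freeH, map_zero]
    simpa [cartan] using this
  | he x i s =>
    have := B.proj_eq_of_rel (Rel.he x i (-s))
    rw [LieHom.map_lie, map_smul, involutionFree_freeH, involutionFree_freeE]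
    simpa [cartan, rootGen] using this
  | ef i s =>
    have := B.proj_eq_of_rel (Rel.ef i (-s))
    have h2 := B.proj_eq_of_rel (Rel.smul (-1) ((((s : ℤ) : ℂ)) • B.coroot i))
    rw [LieHom.map_lie, involutionFree_freeE, involutionFree_freeE, involutionFree_freeH]
    simpa [cartan, rootGen] using this.trans (by simpa using h2)
  | serre i s j t hne =>
    have h1 : ¬ (i = j ∧ -s = -(-t)) := fun h => hne ⟨h.1, neg_inj.1 h.2⟩
    have := B.proj_eq_of_rel (Rel.serre i (-s) j (-t) h1)
    have hneg : ∀ (n : ℕ) (x y : B.GIMAlgebra),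
        ((LieAlgebra.ad ℂ B.GIMAlgebra x) ^ n) y = 0 →
        ((LieAlgebra.ad ℂ B.GIMAlgebra (-x)) ^ n) (-y) = 0 := by
      intro n x y hxy
      rw [map_neg, map_neg, neg_pow, Module.End.mul_apply, hxy, map_zero, neg_zero]
    rw [map_ad_pow, involutionFree_freeE, involutionFree_freeE, map_zero]
    apply hneg
    rw [map_ad_pow, map_zero] at this
    simpa [rootGen] using this

/-- The Chevalley involution `ω`, the (complex linear) automorphism with `ω(h) = -h` for `h ∈ 𝔥`,
`ω(e_i) = -f_i` and `ω(f_i) = -e_i`. -/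
def chevalleyInvolution (B : RootBasis A 𝔥) : B.GIMAlgebra →ₗ⁅ℂ⁆ B.GIMAlgebra :=
  B.lift B.involutionFree B.involutionFree_rel

theorem chevalleyInvolution_rootGen (B : RootBasis A 𝔥) (i : ι) (s : ℤˣ) :
    B.chevalleyInvolution (B.rootGen i s) = -B.rootGen i (-s) :=
  (B.lift_proj _ _ _).trans (B.involutionFree_freeE i s)

/-- The maximal compact subalgebra `𝔨 = Fix_ω`. -/
def maximalCompact (B : RootBasis A 𝔥) : LieSubalgebra ℂ B.GIMAlgebra where
  carrier := {x | B.chevalleyInvolution x = x}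
  add_mem' := fun {x y} (hx : _ = _) (hy : _ = _) => by
    simp only [Set.mem_ofPred_eq, map_add, hx, hy]
  zero_mem' := map_zero _
  smul_mem' := fun c x (hx : _ = _) => by simp only [Set.mem_ofPred_eq, map_smul, hx]
  lie_mem' := fun {x y} (hx : _ = _) (hy : _ = _) => by
    change B.chevalleyInvolution ⁅x, y⁆ = ⁅x, y⁆
    rw [LieHom.map_lie, hx, hy]

/-- The Berman generator `x_i = e_i - f_i`. -/
def berman (B : RootBasis A 𝔥) (i : ι) : B.maximalCompact :=
  ⟨B.rootGen i 1 - B.rootGen i (-1), by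
    change B.chevalleyInvolution _ = _
    rw [map_sub, chevalleyInvolution_rootGen, chevalleyInvolution_rootGen, neg_neg]
    abel⟩

end RootBasis

/-! ### The matrices `E₉` and `B₄^⋄` -/

/-- The generalised Cartan matrix of affine type `E₉ = E₈^(1)`, with nodes labelled `1, …, 9`: the
nodes `1, …, 8` form a chain (type `A₈`) and node `9` is attached to node `3`. Node `k` has index
`k - 1`. -/
def cartanE9 : Matrix (Fin 9) (Fin 9) ℤ :=
  !![ 2, -1,  0,  0,  0,  0,  0,  0,  0;
     -1,  2, -1,  0,  0,  0,  0,  0,  0;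
      0, -1,  2, -1,  0,  0,  0,  0, -1;
      0,  0, -1,  2, -1,  0,  0,  0,  0;
      0,  0,  0, -1,  2, -1,  0,  0,  0;
      0,  0,  0,  0, -1,  2, -1,  0,  0;
      0,  0,  0,  0,  0, -1,  2, -1,  0;
      0,  0,  0,  0,  0,  0, -1,  2,  0;
      0,  0, -1,  0,  0,  0,  0,  0,  2]

/-- The generalised intersection matrix `B₄^⋄`, with nodes labelled `0, …, 4`. -/
def gimB4Diamond : Matrix (Fin 5) (Fin 5) ℤ :=
  !![ 2, -2,  2,  0,  0;
     -1,  2, -1,  0,  0;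
      1, -1,  2, -1,  0;
      0,  0, -1,  2, -1;
      0,  0,  0, -2,  2]

/-- The Berman generators `x_1, …, x_9` of `𝔨(E₉)(ℂ)`, by label. -/
def bermanE9 {𝔥 : Type*} [AddCommGroup 𝔥] [Module ℂ 𝔥] (B : RootBasis cartanE9 𝔥) (k : ℕ) :
    B.maximalCompact :=
  B.berman (Fin.ofNat 9 (k - 1))

/-! ### Elements built from the Berman generators -/

namespace Berman

variable {L : Type*} [LieRing L] [LieAlgebra ℂ L]

/-- `[x_a, [x_{a+1}, … [x_{a+d-1}, x_{a+d}]…]]` -/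
def chain (x : ℕ → L) (a : ℕ) : ℕ → L
  | 0 => x a
  | d + 1 => ⁅x a, chain x (a + 1) d⁆

/-- `x_{α_a + ⋯ + α_b} = [x_a, [x_{a+1}, … [x_{b-1}, x_b]…]]` for `a ≤ b`. -/
def chainTo (x : ℕ → L) (a b : ℕ) : L := chain x a (b - a)

/-- `H_j = -i x_{2j-1}` for `j = 1, …, 4`. -/
def cartanH (x : ℕ → L) (j : ℕ) : L := (-Complex.I) • x (2 * j - 1)

/-- `e_{ε₁ L_i + ε₂ L_j}` for `1 ≤ i < j ≤ 4` and signs `ε₁, ε₂ = ±1`. -/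
def longRootVec (x : ℕ → L) (ε₁ ε₂ : ℂ) (i j : ℕ) : L :=
  (Complex.I / 2) •
    (chainTo x (2 * i) (2 * j - 1) - (Complex.I * ε₂) • chainTo x (2 * i) (2 * j - 2)
      - (Complex.I * ε₁) • chainTo x (2 * i - 1) (2 * j - 1)
      - (ε₁ * ε₂) • chainTo x (2 * i - 1) (2 * j - 2))

/-- `e_{ε L_4} = i (x_8 - ε i [x_7, x_8])` for a sign `ε = ±1`. -/
def shortRootVec (x : ℕ → L) (ε : ℂ) : L :=
  Complex.I • (x 8 - (ε * Complex.I) • ⁅x 7, x 8⁆)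

/-- `e_i = e_{L_i - L_{i+1}}` for `i = 1, 2, 3` and `e_4 = e_{L_4}`. -/
def soE (x : ℕ → L) (i : ℕ) : L :=
  if i = 4 then shortRootVec x 1 else longRootVec x 1 (-1) i (i + 1)

/-- `f_i = e_{-L_i + L_{i+1}}` for `i = 1, 2, 3` and `f_4 = e_{-L_4}`. -/
def soF (x : ℕ → L) (i : ℕ) : L :=
  if i = 4 then shortRootVec x (-1) else longRootVec x (-1) 1 i (i + 1)

/-- `h_i = H_i - H_{i+1}` for `i = 1, 2, 3` and `h_4 = 2 H_4`. -/
def soH (x : ℕ → L) (i : ℕ) : L :=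
  if i = 4 then (2 : ℂ) • cartanH x 4 else cartanH x i - cartanH x (i + 1)

/-- `x_+ = i (x_9 - i [x_3, x_9])` -/
def xPlus (x : ℕ → L) : L := Complex.I • (x 9 - Complex.I • ⁅x 3, x 9⁆)

/-- `x_- = i (x_9 + i [x_3, x_9])` -/
def xMinus (x : ℕ → L) : L := Complex.I • (x 9 + Complex.I • ⁅x 3, x 9⁆)

end Berman

end

/-! The Berman generators satisfy `[x_i,x_j] = 0` at non-adjacent nodes and `[x_i,[x_i,x_j]] = -x_j`
at adjacent ones. For the chain `x_1, …, x_8` these relations alone force the bracket of `so(9) = Λ²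
ℂ⁹` on the nested brackets (`lie_wedge_wedge`). In a basis of isotropic weight vectors `w_{±k}`
together with `w_0 = e_9`, the elements `e_j`, `f_j`, `H_j` are multiples of wedges of two weight
vectors. The relations among nodes 1 to 4 are then finite calculations in type `B_4`. Node 0 is a
second vector of the short weight `L_2`. The elements `x_±` and `2H_2` span the `so(3)` generated by
`x_3` and `x_9`. Under it the vectors `w_{±1} ∧ w_{±2}` and `w_{±3} ∧ w_{±2}` are the extreme weight
vectors of three-dimensional representations (`lie_xSigned_vector`, `lie_xSigned_lie_lie`), while
the `so(5)` on `w_0, w_{±3}, w_{±4}` is centralised. This gives the Serre relations with node 0,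
including those of the positive entries of the matrix (`serre`). The root basis of the source is
arbitrary. The functional `α_0 - (α_2 + α_3 + α_4)` vanishes on the coroots but perhaps not on all
of `𝔱`, whereas the target sees weight `L_2` at node 0. The discrepancy is absorbed by a derivation
of `ℂ[[t]] ⊗ L`, which disappears on the Chevalley subalgebra (`RootBasis.exists_chevalleyHom`). The
same device rescales `E_0 ↦ c x_+`, `F_0 ↦ c⁻¹ x_-` freely. Surjectivity holds because the fixed
points of `ω` are generated by the Berman generators (`lieSpan_berman`), and these are recovered
from the root vectors (`mem_of_rootVec_mem`). Both terms of the kernel element have weight `L_1 +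
L_2`, and both go to `i w_1 ∧ w_2` when `c = 1`. For general `c` the first image is multiplied by
`c²` and the second is unchanged. So `c = 2` separates the terms in the source, provided `w_1 ∧ w_2
≠ 0`. This reduces to `x_1 ≠ 0`, hence to the coroot `h_1` surviving in the Kac–Moody algebra, which
is seen on quotients of Verma modules (`exists_highestWeight`). -/

noncomputable section

set_option linter.unusedSectionVars false

open scoped TensorProduct

/-! ### Homomorphisms out of a GIM-Lie algebra -/

namespace RootBasis

variable {ι : Type*} {A : Matrix ι ι ℤ} {𝔥 : Type*} [AddCommGroup 𝔥] [Module ℂ 𝔥]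

/-- The universal property of the GIM-Lie algebra in terms of generators. -/
theorem exists_gimHom (B : RootBasis A 𝔥) {L : Type*} [LieRing L] [LieAlgebra ℂ L]
    (η : 𝔥 →ₗ[ℂ] L) (X : ι → ℤˣ → L) (hη : ∀ x y, ⁅η x, η y⁆ = 0)
    (hX : ∀ x i s, ⁅η x, X i s⁆ = (((s : ℤ) : ℂ) * B.root i x) • X i s)
    (hef : ∀ i s, ⁅X i s, X i (-s)⁆ = ((s : ℤ) : ℂ) • η (B.coroot i))
    (hserre : ∀ i s j t, ¬ (i = j ∧ s = -t) →
      ((LieAlgebra.ad ℂ L (X i s)) ^ (max 1 (1 - (s : ℤ) * (t : ℤ) * A i j)).toNat) (X j t) = 0) :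
    ∃ Φ : B.GIMAlgebra →ₗ⁅ℂ⁆ L, (∀ x, Φ (B.cartan x) = η x) ∧ ∀ i s, Φ (B.rootGen i s) = X i s := by
  let g : GIMGen ι 𝔥 → L := fun | GIMGen.h x => η x | GIMGen.e i s => X i s
  have gh : ∀ x, FreeLieAlgebra.lift ℂ g (freeH ι x) = η x :=
    fun x => FreeLieAlgebra.lift_of_apply g (GIMGen.h x)
  have ge : ∀ i s, FreeLieAlgebra.lift ℂ g (freeE 𝔥 i s) = X i s :=
    fun i s => FreeLieAlgebra.lift_of_apply g (GIMGen.e i s)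
  refine ⟨B.lift (FreeLieAlgebra.lift ℂ g) ?_, gh, ge⟩
  intro a b h
  cases h with
  | add x y => simp only [gh, map_add]
  | smul c x => simp only [gh, map_smul]
  | hh x y => simp only [LieHom.map_lie, gh, hη, map_zero]
  | he x i s => simp only [LieHom.map_lie, gh, ge, hX, map_smul]
  | ef i s => simp only [LieHom.map_lie, gh, ge, hef, map_smul]
  | serre i s j t hne => rw [map_ad_pow, ge, ge, hserre i s j t hne, map_zero]

end RootBasis

/-! ### Derivations and evaluations of scalar extensions -/

namespace LieAlgebra.ExtendScalars

variable {R A L : Type*} [CommRing R] [CommRing A] [Algebra R A] [LieRing L] [LieAlgebra R L]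

/-- A derivation of the coefficient ring extends to the scalar extension of a Lie algebra. -/
def derivation (D : Derivation R A A) : LieDerivation R (A ⊗[R] L) (A ⊗[R] L) where
  toLinearMap := (D : A →ₗ[R] A).rTensor L
  leibniz' x y := by
    induction x using TensorProduct.induction_on with
    | zero => simp
    | add x x' hx hx' =>
      rw [add_lie, map_add, hx, hx', map_add, add_lie, lie_add]; abel
    | tmul a u =>
      induction y using TensorProduct.induction_on with
      | zero => simp
      | add y y' hy hy' =>
        rw [lie_add, map_add, hy, hy', map_add, add_lie, lie_add]; abel
      | tmul b v =>
        simp only [bracket_tmul, LinearMap.rTensor_tmul, Derivation.coeFn_coe, Derivation.leibniz,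
          smul_eq_mul, TensorProduct.add_tmul]
        rw [← lie_skew u v, TensorProduct.tmul_neg, TensorProduct.tmul_neg, sub_eq_add_neg]

@[simp] theorem derivation_tmul (D : Derivation R A A) (a : A) (u : L) :
    derivation D (a ⊗ₜ[R] u) = D a ⊗ₜ[R] u := rfl

/-- A character of the coefficient ring gives an evaluation map on the scalar extension. -/
def eval (ε : A →ₐ[R] R) : A ⊗[R] L →ₗ⁅R⁆ L where
  toLinearMap := (TensorProduct.lid R L).toLinearMap ∘ₗ (ε.toLinearMap).rTensor L
  map_lie' := fun {x y} => by
    induction x using TensorProduct.induction_on with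
    | zero => simp
    | add x x' hx hx' => simp_all [add_lie]
    | tmul a u =>
      induction y using TensorProduct.induction_on with
      | zero => simp
      | add y y' hy hy' => simp_all [lie_add]
      | tmul b v => simp [mul_smul, smul_comm (ε a) (ε b)]

@[simp] theorem eval_tmul (ε : A →ₐ[R] R) (a : A) (u : L) :
    eval ε (a ⊗ₜ[R] u) = ε a • u := rfl

/-- Serre relations of `L` therefore persist in `A ⊗ L`, whatever coefficients are attached to the
generators. -/
theorem ad_pow_tmul (a b : A) (u v : L) (n : ℕ) :
    ((ad R (A ⊗[R] L) (a ⊗ₜ[R] u)) ^ n) (b ⊗ₜ[R] v) = (a ^ n * b) ⊗ₜ[R] ((ad R L u ^ n) v) := by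
  induction n with
  | zero => simp
  | succ n ih =>
    rw [pow_succ', Module.End.mul_apply, ih, ad_apply, bracket_tmul, pow_succ', pow_succ',
      Module.End.mul_apply, ad_apply, mul_assoc]

end LieAlgebra.ExtendScalars

/-- A Lie subalgebra containing the generators of a free Lie algebra is everything. -/
theorem FreeLieAlgebra.eq_top_of_forall_of_mem {R X : Type*} [CommRing R]
    (N : LieSubalgebra R (FreeLieAlgebra R X)) (h : ∀ x, FreeLieAlgebra.of R x ∈ N) : N = ⊤ := by
  -- The generators lift to a map into `N`, and following it by the inclusion fixes every generator.
  have key : N.incl.comp (FreeLieAlgebra.lift R fun x => (⟨_, h x⟩ : N)) = LieHom.id :=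
    FreeLieAlgebra.hom_ext fun x => by simp
  refine eq_top_iff.2 fun y _ => ?_
  have := LieHom.congr_fun key y
  rw [LieHom.id_apply] at this
  rw [← this]
  exact (FreeLieAlgebra.lift R (fun x => (⟨_, h x⟩ : N)) y).2

/-! ### Homomorphisms out of the Chevalley subalgebra -/

namespace RootBasis

variable {ι : Type*} {A : Matrix ι ι ℤ} {𝔥 : Type*} [AddCommGroup 𝔥] [Module ℂ 𝔥]

open LieAlgebra.ExtendScalars in
/-- Elements of a Lie algebra `L` that satisfy the GIM-relations up to an additional derivation
`δ` which kills the coroots define a homomorphism from the Chevalley subalgebra to `L`; moreover the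
images of the generators may be rescaled. -/
theorem exists_chevalleyHom (B : RootBasis A 𝔥) {L : Type*} [LieRing L] [LieAlgebra ℂ L]
    (η : 𝔥 →ₗ[ℂ] L) (δ : 𝔥 →ₗ[ℂ] ℂ) (n : ι → ℕ) (c : ι → ℂˣ) (X : ι → ℤˣ → L)
    (hη : ∀ x y, ⁅η x, η y⁆ = 0) (hδ : ∀ i, δ (B.coroot i) = 0)
    (hX : ∀ x i s, ⁅η x, X i s⁆ = (((s : ℤ) : ℂ) * (B.root i x - n i * δ x)) • X i s)
    (hef : ∀ i s, ⁅X i s, X i (-s)⁆ = ((s : ℤ) : ℂ) • η (B.coroot i))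
    (hserre : ∀ i s j t, ¬ (i = j ∧ s = -t) →
      ((LieAlgebra.ad ℂ L (X i s)) ^ (max 1 (1 - (s : ℤ) * (t : ℤ) * A i j)).toNat) (X j t) = 0) :
    ∃ φ : B.chevalleySubalgebra →ₗ⁅ℂ⁆ L, ∀ i, φ (B.chevE i) = (c i : ℂ) • X i 1 ∧
      φ (B.chevF i) = ((c i)⁻¹ : ℂ) • X i (-1) ∧ φ (B.chevH i) = η (B.coroot i) := by
  let D : Derivation ℂ (PowerSeries ℂ) (PowerSeries ℂ) := PowerSeries.derivative ℂ
  -- The identity map lets all derivations act in the semidirect product. Only multiples of `d/dt`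
  -- will be used.
  let ψ : LieDerivation ℂ (PowerSeries ℂ ⊗[ℂ] L) (PowerSeries ℂ ⊗[ℂ] L) →ₗ⁅ℂ⁆ LieDerivation ℂ (PowerSeries ℂ ⊗[ℂ] L) (PowerSeries ℂ ⊗[ℂ] L) := LieHom.id
  let ε : PowerSeries ℂ →ₐ[ℂ] ℂ :=
    { PowerSeries.constantCoeff (R := ℂ) with commutes' := fun r => by simp }
  -- `T_{i,s} = c_i^s exp(s n_i t)` is an eigenvector of `d/dt` with eigenvalue `s n_i`. This
  -- supplies exactly the part `s n_i δ(x)` of the weight that is missing in `hX`. Its constant term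
  -- is the scaling factor.
  obtain ⟨T, hT, hD, hε, hε'⟩ : ∃ T : ι → ℤˣ → PowerSeries ℂ, (∀ i s, T i s * T i (-s) = 1) ∧
      (∀ i s, D (T i s) = (((s : ℤ) : ℂ) * n i) • T i s) ∧ (∀ i, ε (T i 1) = c i) ∧
      (∀ i, ε (T i (-1)) = (c i : ℂ)⁻¹) := by
    let e : PowerSeries ℂ := PowerSeries.exp ℂ
    let e' : PowerSeries ℂ := PowerSeries.evalNegHom e
    have he : e * e' = 1 := PowerSeries.exp_mul_exp_neg_eq_one
    have hDe : D e = e := PowerSeries.derivative_exp ℂ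
    have hDe' : D e' = -e' := by
      have h : e * D e' + e' * e = 0 := by
        have := congrArg D he
        rwa [D.leibniz, hDe, D.map_one_eq_zero] at this
      linear_combination e' * h - (D e' + e') * he
    have h1 : ε e = 1 := PowerSeries.constantCoeff_exp
    have h2 : ε e' = 1 := by simpa [h1] using congrArg ε he
    have hpow : ∀ k : ℕ, D (e ^ k) = (k : ℂ) • e ^ k ∧ D (e' ^ k) = -((k : ℂ) • e' ^ k) := by
      intro k
      induction k with
      | zero => simp
      | succ k ih =>
        simp only [pow_succ, D.leibniz, ih, hDe, hDe', Nat.cast_succ, smul_eq_mul, Algebra.smul_def,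
          map_add, map_one]
        constructor <;> ring
    refine ⟨fun i s => if s = 1 then (c i : ℂ) • e ^ n i else (c i : ℂ)⁻¹ • e' ^ n i, ?_, ?_, ?_, ?_⟩
    · intro i s
      rcases Int.units_eq_one_or s with rfl | rfl
      · simp [← mul_pow, he, smul_smul]
      · simp [← mul_pow, mul_comm e', he, smul_smul]
    · intro i s
      rcases Int.units_eq_one_or s with rfl | rfl
      · simp [hpow, smul_comm (c i : ℂ)]
      · simp [hpow, smul_comm (c i : ℂ)⁻¹]
    · simp [h1]
    · simp [h2]
  let η' : 𝔥 →ₗ[ℂ] (PowerSeries ℂ ⊗[ℂ] L) ⋊⁅ψ⁆ (LieDerivation ℂ (PowerSeries ℂ ⊗[ℂ] L) (PowerSeries ℂ ⊗[ℂ] L)) :=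
    { toFun := fun x => ⟨1 ⊗ₜ[ℂ] η x, δ x • derivation D⟩
      map_add' := fun x y => by simp [TensorProduct.tmul_add, add_smul]
      map_smul' := fun c x => by simp [TensorProduct.tmul_smul, mul_smul] }
  have hη' (x : 𝔥) : η' x = ⟨1 ⊗ₜ[ℂ] η x, δ x • derivation D⟩ := rfl
  obtain ⟨Φ, hΦh, hΦe⟩ := B.exists_gimHom η'
    (fun i s => LieAlgebra.SemiDirectSum.inl ψ (T i s ⊗ₜ[ℂ] X i s))
    (fun x y => by
      simp [hη', hη, ψ])
    (fun x i s => by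
      simp [hη', hX, ψ, hD, TensorProduct.smul_tmul', TensorProduct.tmul_smul]
      rw [← TensorProduct.add_tmul]
      congr 1; module)
    (fun i s => by
      simp [hη', hef, hT, hδ])
    (fun i s j t hne => by
      rw [← map_ad_pow, ad_pow_tmul, hserre i s j t hne, TensorProduct.tmul_zero, map_zero])
  -- As `δ` kills the coroots, the Chevalley generators have no derivation component. On the
  -- subalgebra they generate, taking the `ℂ[[t]] ⊗ L` component and then setting `t = 0` respects
  -- brackets.
  have hmem : ∀ x ∈ B.chevalleySubalgebra, (Φ x).right = 0 := by
    have : B.chevalleySubalgebra ≤ ((LieAlgebra.SemiDirectSum.projr ψ).comp Φ).ker.toLieSubalgebra := by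
      refine LieSubalgebra.lieSpan_le.2 ?_
      rintro _ ((⟨i, rfl⟩ | ⟨i, rfl⟩) | ⟨i, rfl⟩) <;> simp [hΦh, hΦe, hη', hδ]
    intro x hx
    simpa using this hx
  refine ⟨{ toFun := fun x => eval ε (Φ x).left
            map_add' := fun x y => by simp
            map_smul' := fun x y => by simp
            map_lie' := fun {x y} => by simp [hmem _ x.2, hmem _ y.2] }, fun i => ⟨?_, ?_, ?_⟩⟩
  · simp [chevE, hΦe, hε]
  · simp [chevF, hΦe, hε']
  · simp [chevH, hΦh, hη']

end RootBasis

namespace RootBasis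

variable {ι : Type*} {A : Matrix ι ι ℤ} {𝔥 : Type*} [AddCommGroup 𝔥] [Module ℂ 𝔥]

/-! ### Relations between the generators -/

theorem cartan_smul (B : RootBasis A 𝔥) (c : ℂ) (x : 𝔥) : B.cartan (c • x) = c • B.cartan x :=
  (B.proj_eq_of_rel (Rel.smul c x)).trans (map_smul B.proj _ _)

theorem lie_cartan_cartan (B : RootBasis A 𝔥) (x y : 𝔥) : ⁅B.cartan x, B.cartan y⁆ = 0 :=
  (B.proj_eq_of_rel (Rel.hh x y)).trans (map_zero B.proj)

theorem lie_cartan_rootGen (B : RootBasis A 𝔥) (x : 𝔥) (i : ι) (s : ℤˣ) :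
    ⁅B.cartan x, B.rootGen i s⁆ = (((s : ℤ) : ℂ) * B.root i x) • B.rootGen i s :=
  (B.proj_eq_of_rel (Rel.he x i s)).trans (map_smul B.proj _ _)

theorem lie_rootGen_neg (B : RootBasis A 𝔥) (i : ι) (s : ℤˣ) :
    ⁅B.rootGen i s, B.rootGen i (-s)⁆ = ((s : ℤ) : ℂ) • B.cartan (B.coroot i) :=
  (B.proj_eq_of_rel (Rel.ef i s)).trans (B.cartan_smul _ _)

theorem ad_pow_rootGen (B : RootBasis A 𝔥) (i : ι) (s : ℤˣ) (j : ι) (t : ℤˣ)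
    (hne : ¬ (i = j ∧ s = -t)) :
    ((LieAlgebra.ad ℂ B.GIMAlgebra (B.rootGen i s)) ^
      (max 1 (1 - (s : ℤ) * (t : ℤ) * A i j)).toNat) (B.rootGen j t) = 0 := by
  have := B.proj_eq_of_rel (Rel.serre i s j t hne)
  rwa [map_ad_pow, map_zero] at this

theorem proj_surjective (B : RootBasis A 𝔥) : Function.Surjective B.proj :=
  B.relIdeal.toSubmodule.mkQ_surjective

/-- A Lie subalgebra containing the generators is everything. -/
theorem eq_top_of_generators_mem (B : RootBasis A 𝔥) (N : LieSubalgebra ℂ B.GIMAlgebra)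
    (hh : ∀ x, B.cartan x ∈ N) (he : ∀ i s, B.rootGen i s ∈ N) (z : B.GIMAlgebra) : z ∈ N := by
  obtain ⟨y, rfl⟩ := B.proj_surjective z
  have : N.comap B.proj = ⊤ := FreeLieAlgebra.eq_top_of_forall_of_mem _ fun g => by
    cases g with
    | h x => exact hh x
    | e i s => exact he i s
  exact (this ▸ LieSubalgebra.mem_top y : y ∈ N.comap B.proj)

/-- A subspace containing the generators and stable under them is everything. -/
theorem mem_of_forall_lie_mem (B : RootBasis A 𝔥) (M : Submodule ℂ B.GIMAlgebra)
    (hh : ∀ x, B.cartan x ∈ M) (he : ∀ i s, B.rootGen i s ∈ M)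
    (hhM : ∀ x, ∀ m ∈ M, ⁅B.cartan x, m⁆ ∈ M) (heM : ∀ i s, ∀ m ∈ M, ⁅B.rootGen i s, m⁆ ∈ M)
    (z : B.GIMAlgebra) : z ∈ M := by
  -- The elements whose adjoint action stabilises `M` form a subalgebra. It contains the generators,
  -- so `M` is an ideal, in particular a subalgebra containing the generators.
  let S : LieSubalgebra ℂ B.GIMAlgebra :=
    { carrier := {y | ∀ m ∈ M, ⁅y, m⁆ ∈ M}
      add_mem' := fun {a b} ha hb m hm => by rw [add_lie]; exact M.add_mem (ha m hm) (hb m hm)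
      zero_mem' := fun m _ => by rw [zero_lie]; exact M.zero_mem
      smul_mem' := fun c a ha m hm => by rw [smul_lie]; exact M.smul_mem c (ha m hm)
      lie_mem' := fun {a b} ha hb m hm => by
        rw [lie_lie]; exact M.sub_mem (ha _ (hb m hm)) (hb _ (ha m hm)) }
  have hS : ∀ y, y ∈ S := B.eq_top_of_generators_mem S hhM heM
  let N : LieSubalgebra ℂ B.GIMAlgebra := { M with lie_mem' := fun {a b} _ hb => hS a b hb }
  exact B.eq_top_of_generators_mem N hh he z

theorem chevalleyInvolution_cartan (B : RootBasis A 𝔥) (x : 𝔥) :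
    B.chevalleyInvolution (B.cartan x) = -B.cartan x :=
  (B.lift_proj _ _ _).trans (B.involutionFree_freeH x)

/-! ### The fixed points of the Chevalley involution -/

/-- `[e_{i_0}, […, [e_{i_{n-1}}, e_{i_n}]…]]` -/
inductive PositiveWord (B : RootBasis A 𝔥) : ℕ → B.GIMAlgebra → Prop
  | gen (i : ι) : PositiveWord B 0 (B.rootGen i 1)
  | lie (i : ι) {n : ℕ} {w : B.GIMAlgebra} (hw : PositiveWord B n w) :
      PositiveWord B (n + 1) ⁅B.rootGen i 1, w⁆

theorem PositiveWord.exists_lie_cartan {B : RootBasis A 𝔥} {n : ℕ} {w : B.GIMAlgebra}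
    (hw : B.PositiveWord n w) (x : 𝔥) : ∃ c : ℂ, ⁅B.cartan x, w⁆ = c • w := by
  induction hw with
  | gen i => exact ⟨_, B.lie_cartan_rootGen x i 1⟩
  | lie i _ ih =>
    obtain ⟨c, hc⟩ := ih
    exact ⟨_, by rw [leibniz_lie, hc, lie_cartan_rootGen, smul_lie, lie_smul, ← add_smul]⟩

theorem PositiveWord.chevalleyInvolution_apply_apply {B : RootBasis A 𝔥} {n : ℕ}
    {w : B.GIMAlgebra} (hw : B.PositiveWord n w) :
    B.chevalleyInvolution (B.chevalleyInvolution w) = w := by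
  induction hw with
  | gen i => simp [chevalleyInvolution_rootGen]
  | lie i _ ih => simp [chevalleyInvolution_rootGen, ih]

/-- The span of `𝔥` and the words of length at most `n`. -/
def borelFiltration (B : RootBasis A 𝔥) (n : ℕ) : Submodule ℂ B.GIMAlgebra :=
  Submodule.span ℂ (Set.range B.cartan ∪ {w | ∃ m < n, B.PositiveWord m w})

theorem cartan_mem_borelFiltration (B : RootBasis A 𝔥) (n : ℕ) (x : 𝔥) :
    B.cartan x ∈ B.borelFiltration n := Submodule.subset_span (Or.inl ⟨x, rfl⟩)

theorem PositiveWord.mem_borelFiltration {B : RootBasis A 𝔥} {m n : ℕ} {w : B.GIMAlgebra}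
    (hw : B.PositiveWord m w) (h : m < n) : w ∈ B.borelFiltration n :=
  Submodule.subset_span (Or.inr ⟨m, h, hw⟩)

/-- `[e_i, f_j] = 0` for `i ≠ j` if `A` has nonpositive off-diagonal entries. -/
theorem lie_rootGen_one_neg_one (B : RootBasis A 𝔥) (hA : ∀ i j, i ≠ j → A i j ≤ 0) {i j : ι}
    (hij : i ≠ j) (s : ℤˣ) : ⁅B.rootGen i s, B.rootGen j (-s)⁆ = 0 := by
  have := B.ad_pow_rootGen i s j (-s) (fun h => hij h.1)
  have hs : (s : ℤ) * ((-s : ℤˣ) : ℤ) = -1 := by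
    rcases Int.units_eq_one_or s with rfl | rfl <;> rfl
  rwa [hs, max_eq_left (by have := hA i j hij; omega), Int.toNat_one, pow_one] at this

theorem lie_rootGen_mem_borelFiltration_succ (B : RootBasis A 𝔥) (i : ι) (n : ℕ) {v : B.GIMAlgebra}
    (hv : v ∈ B.borelFiltration n) : ⁅B.rootGen i 1, v⁆ ∈ B.borelFiltration (n + 1) := by
  induction hv using Submodule.span_induction with
  | zero => simp
  | add a b _ _ ha hb => rw [lie_add]; exact Submodule.add_mem _ ha hb
  | smul c a _ ha => rw [lie_smul]; exact Submodule.smul_mem _ c ha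
  | mem v hv =>
    rcases hv with ⟨x, rfl⟩ | ⟨m, hm, hw⟩
    · rw [← lie_skew, lie_cartan_rootGen]
      exact Submodule.neg_mem _ (Submodule.smul_mem _ _
        ((PositiveWord.gen i).mem_borelFiltration n.succ_pos))
    · exact (PositiveWord.lie i hw).mem_borelFiltration (Nat.succ_lt_succ hm)

/-- Moving `f_i` past the first letter leaves a Cartan element, which only rescales the remaining
word, plus that letter bracketed with `[f_i, w]`. So `f_i` shortens words, by induction. -/
theorem PositiveWord.lie_neg_mem_borelFiltration {B : RootBasis A 𝔥}
    (hA : ∀ i j, i ≠ j → A i j ≤ 0) {n : ℕ} {w : B.GIMAlgebra} (hw : B.PositiveWord n w) (i : ι) :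
    ⁅B.rootGen i (-1), w⁆ ∈ B.borelFiltration n := by
  have key : ∀ j, ∃ x, ⁅B.rootGen i (-1), B.rootGen j 1⁆ = B.cartan x := fun j => by
    by_cases hij : i = j
    · subst hij
      exact ⟨_, (B.lie_rootGen_neg i (-1)).trans (B.cartan_smul _ _).symm⟩
    · exact ⟨0, (B.lie_rootGen_one_neg_one hA hij (-1)).trans
        (by simpa using (B.cartan_smul 0 0).symm)⟩
  induction hw with
  | gen j =>
    obtain ⟨x, hx⟩ := key j
    exact hx ▸ B.cartan_mem_borelFiltration _ x
  | @lie j n w hw ih =>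
    obtain ⟨x, hx⟩ := key j
    obtain ⟨c, hc⟩ := hw.exists_lie_cartan x
    rw [leibniz_lie, hx, hc]
    exact Submodule.add_mem _ (Submodule.smul_mem _ _ (hw.mem_borelFiltration n.lt_succ_self))
      (B.lie_rootGen_mem_borelFiltration_succ j n ih)

/-- The fixed point subalgebra is generated by the elements `e_i - f_i`. -/
theorem lieSpan_berman (B : RootBasis A 𝔥) (hA : ∀ i j, i ≠ j → A i j ≤ 0) :
    LieSubalgebra.lieSpan ℂ B.maximalCompact (Set.range B.berman) = ⊤ := by
  let ω := B.chevalleyInvolution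
  let K : LieSubalgebra ℂ B.GIMAlgebra :=
    (LieSubalgebra.lieSpan ℂ B.maximalCompact (Set.range B.berman)).map B.maximalCompact.incl
  have hK : ∀ i, B.rootGen i 1 - B.rootGen i (-1) ∈ K := fun i =>
    ⟨B.berman i, LieSubalgebra.subset_lieSpan ⟨i, rfl⟩, rfl⟩
  have ωe : ∀ i, ω (B.rootGen i 1) = -B.rootGen i (-1) := fun i =>
    B.chevalleyInvolution_rootGen i 1
  have ωf : ∀ i, ω (B.rootGen i (-1)) = -B.rootGen i 1 := fun i => by
    simpa using B.chevalleyInvolution_rootGen i (-1)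
  have hspan : ∀ n, (∀ m < n, ∀ w, B.PositiveWord m w → w + ω w ∈ K) →
      ∀ v ∈ B.borelFiltration n, v + ω v ∈ K := by
    intro n hn v hv
    induction hv using Submodule.span_induction with
    | zero => simp
    | add a b _ _ ha hb =>
      rw [map_add, add_add_add_comm]; exact K.add_mem ha hb
    | smul c a _ ha => rw [map_smul, ← smul_add]; exact K.smul_mem c ha
    | mem v hv =>
      rcases hv with ⟨x, rfl⟩ | ⟨m, hm, hw⟩
      · simp [ω, chevalleyInvolution_cartan]
      · exact hn m hm v hw
  have hword : ∀ n w, B.PositiveWord n w → w + ω w ∈ K := by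
    intro n
    induction n using Nat.strong_induction_on with
    | _ n ih =>
      intro w hw
      cases hw with
      | gen i => rw [ωe, ← sub_eq_add_neg]; exact hK i
      | @lie i n w hw =>
        -- `[e_i - f_i, w + ω w]` equals `[e_i, w] + ω[e_i, w]` minus `[f_i, w] + ω[f_i, w]`. The
        -- subtracted term involves shorter words only, so it is in `K` by induction.
        have h1 := K.lie_mem (hK i) (ih n n.lt_succ_self w hw)
        have h2 := hspan n (fun m hm => ih m (hm.trans n.lt_succ_self)) _
          (hw.lie_neg_mem_borelFiltration hA i)
        have := K.add_mem h1 h2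
        rw [LieHom.map_lie, ωf] at this
        rw [LieHom.map_lie, ωe]
        convert this using 1
        simp only [sub_lie, lie_add, neg_lie]
        abel
  -- The triangular decomposition, as a spanning statement only: `𝔥`, the positive words and their
  -- images under `ω` span the algebra.
  let M : Submodule ℂ B.GIMAlgebra := Submodule.span ℂ
    (Set.range B.cartan ∪ {w | ∃ n, B.PositiveWord n w} ∪ {w | ∃ n v, B.PositiveWord n v ∧ w = ω v})
  have hM_h : ∀ x, B.cartan x ∈ M := fun x => Submodule.subset_span (Or.inl (Or.inl ⟨x, rfl⟩))
  have hM_w : ∀ n w, B.PositiveWord n w → w ∈ M := fun n w hw =>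
    Submodule.subset_span (Or.inl (Or.inr ⟨n, hw⟩))
  have hM_ω : ∀ n w, B.PositiveWord n w → ω w ∈ M := fun n w hw =>
    Submodule.subset_span (Or.inr ⟨n, w, hw, rfl⟩)
  have hM_b : ∀ n, ∀ v ∈ B.borelFiltration n, v ∈ M ∧ ω v ∈ M := by
    intro n v hv
    induction hv using Submodule.span_induction with
    | zero => simp
    | add a b _ _ ha hb =>
      rw [map_add]; exact ⟨M.add_mem ha.1 hb.1, M.add_mem ha.2 hb.2⟩
    | smul c a _ ha => rw [map_smul]; exact ⟨M.smul_mem c ha.1, M.smul_mem c ha.2⟩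
    | mem v hv =>
      rcases hv with ⟨x, rfl⟩ | ⟨m, -, hw⟩
      · simp only [ω, chevalleyInvolution_cartan]
        exact ⟨hM_h x, M.neg_mem (hM_h x)⟩
      · exact ⟨hM_w m v hw, hM_ω m v hw⟩
  have hf : ∀ i, B.rootGen i (-1) = -ω (B.rootGen i 1) := fun i => by rw [ωe, neg_neg]
  have he : ∀ i, B.rootGen i 1 = -ω (B.rootGen i (-1)) := fun i => by rw [ωf, neg_neg]
  have hMtop : ∀ z, z ∈ M := by
    have gen_mem : ∀ i s, B.rootGen i s ∈ M := by
      intro i s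
      rcases Int.units_eq_one_or s with rfl | rfl
      · exact hM_w 0 _ (PositiveWord.gen i)
      · rw [hf]; exact M.neg_mem (hM_ω 0 _ (PositiveWord.gen i))
    refine B.mem_of_forall_lie_mem M hM_h gen_mem ?_ ?_
    · intro x m hm
      induction hm using Submodule.span_induction with
      | zero => simp
      | add a b _ _ ha hb => rw [lie_add]; exact M.add_mem ha hb
      | smul c a _ ha => rw [lie_smul]; exact M.smul_mem c ha
      | mem v hv =>
        rcases hv with (⟨y, rfl⟩ | ⟨n, hw⟩) | ⟨n, v, hw, rfl⟩
        · rw [lie_cartan_cartan]; exact M.zero_mem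
        · obtain ⟨c, hc⟩ := hw.exists_lie_cartan x
          rw [hc]; exact M.smul_mem c (hM_w n v hw)
        · obtain ⟨c, hc⟩ := hw.exists_lie_cartan x
          have hx : B.cartan x = -ω (B.cartan x) := by simp [ω, chevalleyInvolution_cartan]
          rw [hx, neg_lie, ← LieHom.map_lie, hc, map_smul]
          exact M.neg_mem (M.smul_mem c (hM_ω n v hw))
    · intro i s m hm
      induction hm using Submodule.span_induction with
      | zero => simp
      | add a b _ _ ha hb => rw [lie_add]; exact M.add_mem ha hb
      | smul c a _ ha => rw [lie_smul]; exact M.smul_mem c ha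
      | mem v hv =>
        rcases hv with (⟨y, rfl⟩ | ⟨n, hw⟩) | ⟨n, v, hw, rfl⟩
        · rw [← lie_skew, lie_cartan_rootGen]; exact M.neg_mem (M.smul_mem _ (gen_mem i s))
        · rcases Int.units_eq_one_or s with rfl | rfl
          · exact hM_w _ _ (PositiveWord.lie i hw)
          · exact (hM_b n _ (hw.lie_neg_mem_borelFiltration hA i)).1
        · rcases Int.units_eq_one_or s with rfl | rfl
          · rw [he, neg_lie, ← LieHom.map_lie]
            exact M.neg_mem (hM_b n _ (hw.lie_neg_mem_borelFiltration hA i)).2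
          · rw [hf, neg_lie, ← LieHom.map_lie]
            exact M.neg_mem (hM_ω _ _ (PositiveWord.lie i hw))
  have hsym : ∀ z ∈ M, z + ω z ∈ K := by
    intro z hz
    induction hz using Submodule.span_induction with
    | zero => simp
    | add a b _ _ ha hb =>
      rw [map_add, add_add_add_comm]; exact K.add_mem ha hb
    | smul c a _ ha => rw [map_smul, ← smul_add]; exact K.smul_mem c ha
    | mem v hv =>
      rcases hv with (⟨y, rfl⟩ | ⟨n, hw⟩) | ⟨n, v, hw, rfl⟩
      · simp [ω, chevalleyInvolution_cartan]
      · exact hword n v hw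
      · rw [hw.chevalleyInvolution_apply_apply, add_comm]; exact hword n v hw
  refine eq_top_iff.2 fun z _ => ?_
  have hz : (z : B.GIMAlgebra) ∈ K := by
    -- A fixed point is the average `(z + ω z) / 2`.
    have h := K.smul_mem (1 / 2 : ℂ) (hsym z (hMtop z))
    rwa [show ω (z : B.GIMAlgebra) = z from z.2, ← two_smul ℂ (z : B.GIMAlgebra), smul_smul,
      one_div_mul_cancel two_ne_zero, one_smul] at h
  obtain ⟨y, hy, hyz⟩ := hz
  rwa [show y = z from Subtype.ext hyz] at hy

/-! ### Relations between the Berman generators -/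

/-- `[x_i, x_j] = 0` if `A_{ij} = 0`. -/
theorem lie_berman_of_eq_zero (B : RootBasis A 𝔥) {i j : ι}
    (hij : i ≠ j) (h : A i j = 0) : ⁅B.berman i, B.berman j⁆ = 0 := by
  have key : ∀ s t, ⁅B.rootGen i s, B.rootGen j t⁆ = 0 := fun s t => by
    simpa [h] using B.ad_pow_rootGen i s j t (fun h => hij h.1)
  apply Subtype.ext
  simp [berman, key]

/-- `[x_i, [x_i, x_j]] = -x_j` if `A_{ij} = -1`. -/
theorem lie_lie_berman_of_eq_neg_one (B : RootBasis A 𝔥) (hA : ∀ i j, i ≠ j → A i j ≤ 0) {i j : ι}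
    (hij : i ≠ j) (h : A i j = -1) :
    ⁅B.berman i, ⁅B.berman i, B.berman j⁆⁆ = -B.berman j := by
  have serre : ∀ s, ⁅B.rootGen i s, ⁅B.rootGen i s, B.rootGen j s⁆⁆ = 0 := fun s => by
    have := B.ad_pow_rootGen i s j s (fun h => hij h.1)
    have hs : (s : ℤ) * (s : ℤ) = 1 := Int.units_coe_mul_self s
    rw [hs, h] at this
    simpa [pow_two] using this
  have comm : ∀ s, ⁅B.rootGen i s, B.rootGen j (-s)⁆ = 0 := B.lie_rootGen_one_neg_one hA hij
  have cross : ∀ s, ⁅B.rootGen i (-s), ⁅B.rootGen i s, B.rootGen j s⁆⁆ = B.rootGen j s := fun s => by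
    have h1 := B.lie_rootGen_neg i (-s)
    have h2 := comm (-s)
    rw [neg_neg] at h1 h2
    rw [leibniz_lie, h1, h2, lie_zero, add_zero, smul_lie, lie_cartan_rootGen, B.root_coroot, h,
      smul_smul]
    rcases Int.units_eq_one_or s with rfl | rfl <;> simp
  have c1 := comm 1
  have c2 := comm (-1)
  have k1 := cross 1
  have k2 := cross (-1)
  rw [neg_neg] at c2 k2
  apply Subtype.ext
  change ⁅B.rootGen i 1 - B.rootGen i (-1), ⁅B.rootGen i 1 - B.rootGen i (-1),
    B.rootGen j 1 - B.rootGen j (-1)⁆⁆ = -(B.rootGen j 1 - B.rootGen j (-1))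
  simp only [sub_lie, lie_sub, serre, c1, c2, k1, k2, lie_zero]
  abel

end RootBasis

/-! ### Serre elements -/

section Serre

variable {L : Type*} [LieRing L] [LieAlgebra ℂ L]

theorem lie_ad_pow_of_eigenvector {h a b : L} {α β : ℂ} (ha : ⁅h, a⁆ = α • a) (hb : ⁅h, b⁆ = β • b)
    (n : ℕ) : ⁅h, ((LieAlgebra.ad ℂ L a) ^ n) b⁆ = (n * α + β) • ((LieAlgebra.ad ℂ L a) ^ n) b := by
  induction n with
  | zero => simp [hb]
  | succ n ih =>
    rw [pow_succ', Module.End.mul_apply, LieAlgebra.ad_apply, leibniz_lie, ha, ih, smul_lie, lie_smul,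
      ← add_smul]
    congr 1; push_cast; ring

/-- In the simply laced case, the Serre elements of the `e_i` commute with all `f_k`. -/
theorem lie_serre_eq_zero {ι : Type*} {A : Matrix ι ι ℤ}
    (hA : ∀ i j, i ≠ j → A i j = 0 ∧ A j i = 0 ∨ A i j = -1)
    (hA2 : ∀ i, A i i = 2) {e f h : ι → L} (hef : ∀ i, ⁅f i, e i⁆ = h i)
    (hef' : ∀ i j, i ≠ j → ⁅f i, e j⁆ = 0) (he : ∀ i j, ⁅h i, e j⁆ = (-(A i j : ℂ)) • e j)
    {i j : ι} (hij : i ≠ j) (k : ι) :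
    ⁅f k, ((LieAlgebra.ad ℂ L (e i)) ^ (max 1 (1 - A i j)).toNat) (e j)⁆ = 0 := by
  rcases hA i j hij with ⟨h1, h2⟩ | h1
  · have : (max 1 (1 - A i j)).toNat = 1 := by rw [h1]; rfl
    rw [this, pow_one, LieAlgebra.ad_apply, leibniz_lie]
    by_cases hki : k = i
    · subst hki; simp [hef, hef' k j hij, he, h1]
    · by_cases hkj : k = j
      · subst hkj
        rw [hef' k i hki, hef, zero_lie, zero_add, ← lie_skew, he, h2]; simp
      · simp [hef' k i hki, hef' k j hkj]
  · have : (max 1 (1 - A i j)).toNat = 2 := by rw [h1]; rfl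
    rw [this, pow_two, Module.End.mul_apply, LieAlgebra.ad_apply, LieAlgebra.ad_apply,
      leibniz_lie, leibniz_lie (f k) (e i)]
    by_cases hki : k = i
    -- The two contributions of `h_i` cancel: coefficient `-2 + 1` from `[h_i, [e_i, e_j]]` and `1`
    -- from `[e_i, [h_i, e_j]]`. Here `h_i = [f_i, e_i]`, a sign convention that lets the lemma
    -- serve for both the raising and the lowering operators.
    · subst hki
      rw [hef, hef' k j hij, lie_zero, add_zero, leibniz_lie, he, he, hA2, h1,
        smul_lie, lie_smul]
      push_cast
      module
    · by_cases hkj : k = j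
      · subst hkj
        rw [hef' k i hki, hef, ← lie_skew (e i) (h k), he, zero_lie, zero_lie, zero_add, zero_add, lie_neg,
          lie_smul, lie_self, smul_zero, neg_zero]
      · simp [hef' k i hki, hef' k j hkj]

end Serre

section

attribute [local instance] LieRing.ofAssociativeRing

theorem Module.End.lie_apply_apply {V : Type*} [AddCommGroup V] [Module ℂ V] (S T : Module.End ℂ V)
    (v : V) : ⁅S, T⁆ v = S (T v) - T (S v) := rfl

end

namespace RootBasis

variable {ι : Type*} {A : Matrix ι ι ℤ} {𝔥 : Type*} [AddCommGroup 𝔥] [Module ℂ 𝔥]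

/-! ### Verma modules -/

section Verma

attribute [local instance] LieRing.ofAssociativeRing

variable (B : RootBasis A 𝔥) (l : Module.Dual ℂ 𝔥)

/-- The weight of the vector `f_{i_1} ⋯ f_{i_n} v` in the Verma module of highest weight `l`. -/
def vermaWeight (w : List ι) : Module.Dual ℂ 𝔥 := l - (w.map B.root).sum

theorem vermaWeight_cons (i : ι) (w : List ι) :
    B.vermaWeight l (i :: w) = B.vermaWeight l w - B.root i := by
  simp only [vermaWeight, List.map_cons, List.sum_cons]; abel

/-- The action of `f_i` on the free module on words. -/
def vermaF (i : ι) : Module.End ℂ (List ι →₀ ℂ) := Finsupp.lmapDomain ℂ ℂ (List.cons i)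

/-- The action of `x ∈ 𝔥` on the free module on words. -/
def vermaH : 𝔥 →ₗ[ℂ] Module.End ℂ (List ι →₀ ℂ) where
  toFun x := Finsupp.linearCombination ℂ fun w => Finsupp.single w (B.vermaWeight l w x)
  map_add' x y := by ext; simp
  map_smul' c x := by ext; simp

open Classical in
/-- The action of `e_i` on words. -/
def vermaEWord (i : ι) : List ι → (List ι →₀ ℂ)
  | [] => 0
  | j :: w => vermaF j (vermaEWord i w) +
      if i = j then Finsupp.single w (B.vermaWeight l w (B.coroot i)) else 0

/-- The action of `e_i` on the free module on words. -/
def vermaE (i : ι) : Module.End ℂ (List ι →₀ ℂ) := Finsupp.linearCombination ℂ (B.vermaEWord l i)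

theorem vermaF_single (i : ι) (w : List ι) (c : ℂ) :
    vermaF i (Finsupp.single w c) = Finsupp.single (i :: w) c := by simp [vermaF]

theorem vermaH_single (x : 𝔥) (w : List ι) (c : ℂ) :
    B.vermaH l x (Finsupp.single w c) = B.vermaWeight l w x • Finsupp.single w c := by
  simp [vermaH, mul_comm]

theorem vermaE_single (i : ι) (w : List ι) (c : ℂ) :
    B.vermaE l i (Finsupp.single w c) = c • B.vermaEWord l i w := by simp [vermaE]

theorem lie_vermaH_vermaH (x y : 𝔥) : ⁅B.vermaH l x, B.vermaH l y⁆ = 0 := by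
  refine Finsupp.lhom_ext fun w c => ?_
  simp only [Module.End.lie_apply_apply, vermaH_single, map_smul,
    LinearMap.zero_apply, smul_smul, mul_comm, sub_self]

theorem lie_vermaH_vermaF (x : 𝔥) (i : ι) :
    ⁅B.vermaH l x, vermaF i⁆ = -B.root i x • vermaF i := by
  refine Finsupp.lhom_ext fun w c => ?_
  simp only [Module.End.lie_apply_apply, vermaH_single, map_smul,
    LinearMap.smul_apply, vermaF_single, vermaWeight_cons, LinearMap.sub_apply]
  module

open Classical in
-- The recursion defining `vermaEWord` is this commutation rule, together with the vanishing on the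
-- empty word.
theorem lie_vermaE_vermaF (i j : ι) :
    ⁅B.vermaE l i, vermaF j⁆ = if i = j then B.vermaH l (B.coroot i) else 0 := by
  refine Finsupp.lhom_ext fun w c => ?_
  simp only [Module.End.lie_apply_apply, vermaF_single, vermaE_single,
    vermaEWord, map_smul, smul_add, add_sub_cancel_left]
  split_ifs
  · rw [vermaH_single]; simp [mul_comm]
  · simp

open Classical in
theorem lie_vermaF_vermaE (i j : ι) :
    ⁅vermaF i, B.vermaE l j⁆ = if i = j then B.vermaH l (-B.coroot i) else 0 := by
  refine LinearMap.ext fun v => ?_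
  have h := LinearMap.congr_fun (B.lie_vermaE_vermaF l j i) v
  rw [Module.End.lie_apply_apply] at h ⊢
  rw [← neg_sub, h]
  by_cases hij : i = j
  · subst hij; simp
  · simp [hij, Ne.symm hij]

theorem lie_vermaH_vermaE (x : 𝔥) (i : ι) :
    ⁅B.vermaH l x, B.vermaE l i⁆ = B.root i x • B.vermaE l i := by
  have key : ∀ w, B.vermaH l x (B.vermaEWord l i w) =
      (B.vermaWeight l w x + B.root i x) • B.vermaEWord l i w := by
    intro w
    induction w with
    | nil => simp [vermaEWord]
    | cons j w ih =>
      have h := LinearMap.congr_fun (B.lie_vermaH_vermaF l x j) (B.vermaEWord l i w)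
      simp only [Module.End.lie_apply_apply, LinearMap.smul_apply, ih,
        map_smul] at h
      rw [vermaEWord, map_add, sub_eq_iff_eq_add.1 h, vermaWeight_cons]
      split_ifs with hij
      · subst hij
        rw [vermaH_single, LinearMap.sub_apply]
        module
      · rw [map_zero, LinearMap.sub_apply]
        module
  refine Finsupp.lhom_ext fun w c => ?_
  simp only [Module.End.lie_apply_apply, vermaH_single, map_smul,
    LinearMap.smul_apply, vermaE_single, key]
  module

/-- The Serre element `ad(f_i)^(1 - A_ij) f_j` acting on words. -/
def vermaSerre (A : Matrix ι ι ℤ) (i j : ι) : Module.End ℂ (List ι →₀ ℂ) :=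
  ((LieAlgebra.ad ℂ (Module.End ℂ (List ι →₀ ℂ)) (vermaF i)) ^ (max 1 (1 - A i j)).toNat) (vermaF j)

/-- The images of Serre elements under products of the `f_k`. -/
inductive VermaRel (A : Matrix ι ι ℤ) : (List ι →₀ ℂ) → Prop
  | serre (i j : ι) (hij : i ≠ j) (v : List ι →₀ ℂ) : VermaRel A (vermaSerre A i j v)
  | lower (k : ι) {v : List ι →₀ ℂ} (hv : VermaRel A v) : VermaRel A (vermaF k v)

/-- The submodule generated by the Serre elements. -/
def vermaKer (A : Matrix ι ι ℤ) : Submodule ℂ (List ι →₀ ℂ) := Submodule.span ℂ {v | VermaRel A v}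

theorem vermaKer_le_of_generators {T : Module.End ℂ (List ι →₀ ℂ)} (J : Submodule ℂ (List ι →₀ ℂ))
    (h : ∀ v, VermaRel A v → T v ∈ J) : vermaKer A ≤ J.comap T :=
  Submodule.span_le.2 h

theorem vermaKer_le_comap_vermaF (k : ι) : vermaKer A ≤ (vermaKer A).comap (vermaF k) :=
  vermaKer_le_of_generators _ fun _ hv => Submodule.subset_span (VermaRel.lower k hv)

theorem vermaKer_le_comap_vermaH (x : 𝔥) : vermaKer A ≤ (vermaKer A).comap (B.vermaH l x) := by
  refine vermaKer_le_of_generators _ fun v hv => ?_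
  induction hv with
  | serre i j hij v =>
    have h := LinearMap.congr_fun (lie_ad_pow_of_eigenvector (B.lie_vermaH_vermaF l x i)
      (B.lie_vermaH_vermaF l x j) (max 1 (1 - A i j)).toNat) v
    rw [Module.End.lie_apply_apply, sub_eq_iff_eq_add] at h
    change B.vermaH l x (vermaSerre A i j v) = _ at h
    rw [h]
    exact Submodule.add_mem _
      (Submodule.smul_mem _ _ (Submodule.subset_span (VermaRel.serre i j hij _)))
      (Submodule.subset_span (VermaRel.serre i j hij _))
  | @lower k v hv ih =>
    have h := LinearMap.congr_fun (B.lie_vermaH_vermaF l x k) v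
    rw [Module.End.lie_apply_apply, sub_eq_iff_eq_add] at h
    change B.vermaH l x (vermaF k v) = _ at h
    rw [h]
    exact Submodule.add_mem _
      (Submodule.smul_mem _ _ (Submodule.subset_span (VermaRel.lower k hv)))
      (vermaKer_le_comap_vermaF k ih)

/-- A Serre element in the `f_i` commutes with every `e_k`. Past further letters `f_j`, `e_k` leaves
only Cartan operators, which already preserve the submodule. -/
theorem vermaKer_le_comap_vermaE (hA : ∀ i j, i ≠ j → A i j = 0 ∧ A j i = 0 ∨ A i j = -1)
    (hA2 : ∀ i, A i i = 2) (k : ι) : vermaKer A ≤ (vermaKer A).comap (B.vermaE l k) := by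
  refine vermaKer_le_of_generators _ fun v hv => ?_
  induction hv with
  | serre i j hij v =>
    have h := LinearMap.congr_fun (lie_serre_eq_zero (e := vermaF) (f := B.vermaE l)
      (h := fun i => B.vermaH l (B.coroot i)) hA hA2
      (fun i => by rw [lie_vermaE_vermaF, if_pos rfl])
      (fun i j hij => by rw [lie_vermaE_vermaF, if_neg hij])
      (fun i j => by rw [lie_vermaH_vermaF, B.root_coroot]) hij k) v
    rw [Module.End.lie_apply_apply, LinearMap.zero_apply, sub_eq_zero] at h
    change B.vermaE l k (vermaSerre A i j v) = vermaSerre A i j (B.vermaE l k v) at h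
    rw [h]
    exact Submodule.subset_span (VermaRel.serre i j hij _)
  | @lower j v hv ih =>
    have h := LinearMap.congr_fun (B.lie_vermaE_vermaF l k j) v
    rw [Module.End.lie_apply_apply, sub_eq_iff_eq_add] at h
    change B.vermaE l k (vermaF j v) = _ at h
    rw [h]
    refine Submodule.add_mem _ ?_ (vermaKer_le_comap_vermaF j ih)
    split_ifs
    · exact B.vermaKer_le_comap_vermaH l _ (Submodule.subset_span hv)
    · exact Submodule.zero_mem _

/-- Every operator built from the `f_i` by brackets prepends letters, so the empty word never
appears in its image. This is why the highest weight vector survives in the quotient. -/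
theorem vermaKer_apply_nil {v : List ι →₀ ℂ} (hv : v ∈ vermaKer A) : v [] = 0 := by
  let S : LieSubalgebra ℂ (Module.End ℂ (List ι →₀ ℂ)) :=
    { carrier := {T | ∀ v, T v [] = 0}
      add_mem' := fun {a b} ha hb v => by simp [ha v, hb v]
      zero_mem' := fun v => rfl
      smul_mem' := fun c a ha v => by simp [ha v]
      lie_mem' := fun {a b} (ha : ∀ v, a v [] = 0) (hb : ∀ v, b v [] = 0) v => by
        rw [Module.End.lie_apply_apply, Finsupp.sub_apply, ha, hb, sub_zero] }
  have hF : ∀ i, vermaF i ∈ S := fun i v =>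
    Finsupp.mapDomain_of_notMem_range _ _ (by simp)
  have hSerre : ∀ i j, vermaSerre A i j ∈ S := by
    intro i j
    unfold vermaSerre
    induction (max 1 (1 - A i j)).toNat with
    | zero => exact hF j
    | succ n ih =>
      rw [pow_succ', Module.End.mul_apply]
      exact S.lie_mem (hF i) ih
  have : vermaKer A ≤ LinearMap.ker (Finsupp.lapply (R := ℂ) (M := ℂ) ([] : List ι)) := by
    refine Submodule.span_le.2 fun v hv => ?_
    cases hv with
    | serre i j hij v => exact hSerre i j v
    | lower k hv => exact hF k _
  exact this hv

/-- The operators that descend to the quotient by the Serre elements. -/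
def vermaStabilizer (A : Matrix ι ι ℤ) : LieSubalgebra ℂ (Module.End ℂ (List ι →₀ ℂ)) where
  carrier := {T | vermaKer A ≤ (vermaKer A).comap T}
  add_mem' := fun ha hb _ hv => (vermaKer A).add_mem (ha hv) (hb hv)
  zero_mem' := fun _ _ => (vermaKer A).zero_mem
  smul_mem' := fun c _ ha _ hv => (vermaKer A).smul_mem c (ha hv)
  lie_mem' := fun ha hb _ hv => (vermaKer A).sub_mem (ha (hb hv)) (hb (ha hv))

/-- The action on the quotient by the Serre elements. -/
def vermaQuot (A : Matrix ι ι ℤ) :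
    vermaStabilizer A →ₗ⁅ℂ⁆ Module.End ℂ ((List ι →₀ ℂ) ⧸ vermaKer A) where
  toFun T := (vermaKer A).mapQ (vermaKer A) T.1 T.2
  map_add' _ _ := by ext; rfl
  map_smul' _ _ := by ext; rfl
  map_lie' := by intros; ext; rfl

/-- The action of `e_{s α_i}` on words. -/
def vermaX (i : ι) (s : ℤˣ) : Module.End ℂ (List ι →₀ ℂ) :=
  if s = 1 then B.vermaE l i else vermaF i

theorem vermaX_one (i : ι) : B.vermaX l i 1 = B.vermaE l i := if_pos rfl

theorem vermaX_neg_one (i : ι) : B.vermaX l i (-1) = vermaF i := if_neg (by decide)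

/-- A Serre element in the `e_i` commutes with all `f_k` and kills the empty word, from which the
`f_k` generate the module. Hence it vanishes even before the quotient is taken. -/
theorem vermaSerre_pos_eq_zero (hA : ∀ i j, i ≠ j → A i j = 0 ∧ A j i = 0 ∨ A i j = -1)
    (hA2 : ∀ i, A i i = 2) {i j : ι} (hij : i ≠ j) :
    ((LieAlgebra.ad ℂ (Module.End ℂ (List ι →₀ ℂ)) (B.vermaE l i)) ^ (max 1 (1 - A i j)).toNat)
      (B.vermaE l j) = 0 := by
  have comm := fun k => lie_serre_eq_zero (e := B.vermaE l) (f := vermaF)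
    (h := fun i => B.vermaH l (-B.coroot i)) hA hA2
    (fun i => by rw [lie_vermaF_vermaE, if_pos rfl])
    (fun i j hij => by rw [lie_vermaF_vermaE, if_neg hij])
    (fun i j => by rw [lie_vermaH_vermaE, map_neg, B.root_coroot]) hij k
  let S : LieSubalgebra ℂ (Module.End ℂ (List ι →₀ ℂ)) :=
    { carrier := {T | ∀ c, T (Finsupp.single [] c) = 0}
      add_mem' := fun {a b} ha hb v => by simp [ha v, hb v]
      zero_mem' := fun v => rfl
      smul_mem' := fun c a ha v => by simp [ha v]
      lie_mem' := fun {a b} (ha : ∀ c, a (Finsupp.single [] c) = 0)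
          (hb : ∀ c, b (Finsupp.single [] c) = 0) c => by
        rw [Module.End.lie_apply_apply, ha, hb, map_zero, map_zero, sub_zero] }
  have hE : ∀ i, B.vermaE l i ∈ S := fun i c => by rw [vermaE_single, vermaEWord, smul_zero]
  have hmem : ((LieAlgebra.ad ℂ (Module.End ℂ (List ι →₀ ℂ)) (B.vermaE l i)) ^
      (max 1 (1 - A i j)).toNat) (B.vermaE l j) ∈ S := by
    induction (max 1 (1 - A i j)).toNat with
    | zero => exact hE j
    | succ n ih =>
      rw [pow_succ', Module.End.mul_apply]
      exact S.lie_mem (hE i) ih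
  refine Finsupp.lhom_ext fun w => ?_
  induction w with
  | nil => exact hmem
  | cons k w ih =>
    intro c
    have h := LinearMap.congr_fun (comm k) (Finsupp.single w c)
    rw [Module.End.lie_apply_apply, ih, LinearMap.zero_apply, map_zero, zero_sub, neg_eq_zero,
      vermaF_single] at h
    exact h

/-- In the simply laced case every weight is the highest weight of a representation of the
GIM-Lie algebra. -/
theorem exists_highestWeight (hA : ∀ i j, i ≠ j → A i j = 0 ∧ A j i = 0 ∨ A i j = -1)
    (hA2 : ∀ i, A i i = 2) :
    ∃ Φ : B.GIMAlgebra →ₗ⁅ℂ⁆ Module.End ℂ ((List ι →₀ ℂ) ⧸ vermaKer A),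
      ∃ v, v ≠ 0 ∧ ∀ x, Φ (B.cartan x) v = l x • v := by
  have memX : ∀ i s, B.vermaX l i s ∈ vermaStabilizer A := by
    intro i s
    rcases Int.units_eq_one_or s with rfl | rfl
    · rw [vermaX_one]; exact B.vermaKer_le_comap_vermaE l hA hA2 i
    · rw [vermaX_neg_one]; exact vermaKer_le_comap_vermaF i
  let X : ι → ℤˣ → vermaStabilizer A := fun i s => ⟨B.vermaX l i s, memX i s⟩
  let η : 𝔥 →ₗ[ℂ] vermaStabilizer A :=
    LinearMap.codRestrict (vermaStabilizer A).toSubmodule (B.vermaH l)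
      (B.vermaKer_le_comap_vermaH l)
  have coe_ad : ∀ (n : ℕ) (S T : vermaStabilizer A),
      (((LieAlgebra.ad ℂ (vermaStabilizer A) S ^ n) T : vermaStabilizer A) :
        Module.End ℂ (List ι →₀ ℂ)) = (LieAlgebra.ad ℂ _ (S : Module.End ℂ _) ^ n) T :=
    fun n S T => map_ad_pow (vermaStabilizer A).incl S T n
  have hom : ∃ Φ : B.GIMAlgebra →ₗ⁅ℂ⁆ Module.End ℂ ((List ι →₀ ℂ) ⧸ vermaKer A),
      (∀ x, Φ (B.cartan x) = vermaQuot A (η x)) ∧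
        ∀ i s, Φ (B.rootGen i s) = vermaQuot A (X i s) := by
    refine B.exists_gimHom ((vermaQuot A : _ →ₗ[ℂ] _) ∘ₗ η) (fun i s => vermaQuot A (X i s))
      ?_ ?_ ?_ ?_
    · intro x y
      have : ⁅η x, η y⁆ = 0 := Subtype.ext (B.lie_vermaH_vermaH l x y)
      simp only [LinearMap.comp_apply, LieHom.coe_toLinearMap, ← LieHom.map_lie, this, map_zero]
    · intro x i s
      have : ⁅η x, X i s⁆ = (((s : ℤ) : ℂ) * B.root i x) • X i s := by
        apply Subtype.ext
        change ⁅B.vermaH l x, B.vermaX l i s⁆ = _ • B.vermaX l i s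
        rcases Int.units_eq_one_or s with rfl | rfl
        · simp [vermaX_one, lie_vermaH_vermaE]
        · rw [vermaX_neg_one, lie_vermaH_vermaF]; congr 1; simp
      simp only [LinearMap.comp_apply, LieHom.coe_toLinearMap, ← LieHom.map_lie, this, map_smul]
    · intro i s
      have : ⁅X i s, X i (-s)⁆ = ((s : ℤ) : ℂ) • η (B.coroot i) := by
        apply Subtype.ext
        change ⁅B.vermaX l i s, B.vermaX l i (-s)⁆ = _ • B.vermaH l (B.coroot i)
        rcases Int.units_eq_one_or s with rfl | rfl
        · simp [vermaX_one, vermaX_neg_one, lie_vermaE_vermaF]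
        · rw [neg_neg, vermaX_one, vermaX_neg_one, lie_vermaF_vermaE, if_pos rfl, map_neg]; simp
      simp only [LinearMap.comp_apply, LieHom.coe_toLinearMap, ← LieHom.map_lie, this, map_smul]
    · intro i s j t hne
      rw [← map_ad_pow]
      have hle : i ≠ j → A i j ≤ 0 := fun hij => by
        rcases hA i j hij with h | h <;> omega
      rcases Int.units_eq_one_or s with rfl | rfl <;> rcases Int.units_eq_one_or t with rfl | rfl
      · by_cases hij : i = j
        · subst hij; simp [hA2]
        · have : (LieAlgebra.ad ℂ (vermaStabilizer A) (X i 1) ^ (max 1 (1 - A i j)).toNat) (X j 1) = 0 := by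
            apply Subtype.ext
            rw [coe_ad]
            simpa [X, vermaX_one] using B.vermaSerre_pos_eq_zero l hA hA2 hij
          simpa using congrArg (vermaQuot A) this
      · have hij : i ≠ j := fun h => hne ⟨h, rfl⟩
        have : ⁅X i 1, X j (-1)⁆ = 0 := by
          apply Subtype.ext
          change ⁅B.vermaX l i 1, B.vermaX l j (-1)⁆ = 0
          rw [vermaX_one, vermaX_neg_one, lie_vermaE_vermaF, if_neg hij]
        have hn : (max 1 (1 - ((1 : ℤˣ) : ℤ) * ((-1 : ℤˣ) : ℤ) * A i j)).toNat = 1 := by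
          have := hle hij
          simp; omega
        rw [hn, pow_one, LieAlgebra.ad_apply, this, map_zero]
      · have hij : i ≠ j := fun h => hne ⟨h, rfl⟩
        have : ⁅X i (-1), X j 1⁆ = 0 := by
          apply Subtype.ext
          change ⁅B.vermaX l i (-1), B.vermaX l j 1⁆ = 0
          rw [vermaX_one, vermaX_neg_one, lie_vermaF_vermaE, if_neg hij]
        have hn : (max 1 (1 - ((-1 : ℤˣ) : ℤ) * ((1 : ℤˣ) : ℤ) * A i j)).toNat = 1 := by
          have := hle hij
          simp; omega
        rw [hn, pow_one, LieAlgebra.ad_apply, this, map_zero]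
      · by_cases hij : i = j
        · subst hij; simp [hA2]
        -- The Serre relations of the `f_i` are the only ones that need the quotient.
        · refine LinearMap.ext fun v => ?_
          obtain ⟨v, rfl⟩ := Submodule.mkQ_surjective _ v
          refine (Submodule.Quotient.mk_eq_zero _).2 ?_
          rw [coe_ad]
          have : (max 1 (1 - ((-1 : ℤˣ) : ℤ) * ((-1 : ℤˣ) : ℤ) * A i j)) = max 1 (1 - A i j) := by simp
          rw [this]
          simp only [X, vermaX_neg_one]
          exact Submodule.subset_span (VermaRel.serre i j hij v)
  obtain ⟨Φ, hΦ, -⟩ := hom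
  refine ⟨Φ, (vermaKer A).mkQ (Finsupp.single [] 1), ?_, fun x => ?_⟩
  · intro h
    have := vermaKer_apply_nil ((Submodule.Quotient.mk_eq_zero _).1 h)
    simp at this
  · rw [hΦ, ← map_smul]
    change (vermaKer A).mkQ (B.vermaH l x (Finsupp.single [] 1)) = _
    rw [vermaH_single]
    simp [vermaWeight]

/-- In the simply laced case, `𝔥` embeds into the GIM-Lie algebra. -/
theorem eq_zero_of_cartan_eq_zero (hA : ∀ i j, i ≠ j → A i j = 0 ∧ A j i = 0 ∨ A i j = -1)
    (hA2 : ∀ i, A i i = 2) {x : 𝔥} (hx : B.cartan x = 0) : x = 0 := by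
  -- On a highest weight vector of weight `l`, `cartan x` acts by `l x`. Since `l` is arbitrary,
  -- these representations separate the points of `𝔥`.
  refine (Module.forall_dual_apply_eq_zero_iff ℂ x).1 fun l => ?_
  obtain ⟨Φ, v, hv, h⟩ := B.exists_highestWeight l hA hA2
  have := h x
  rw [hx, map_zero, LinearMap.zero_apply] at this
  exact (smul_eq_zero.1 this.symm).resolve_right hv

end Verma

end RootBasis

/-! ### Consequences of the Berman relations of type `E_9` -/

namespace Berman

variable {L : Type*} [LieRing L] [LieAlgebra ℂ L]

/-- The relations of the Berman generators in type `E₉`. -/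
structure RelationsE9 (x : ℕ → L) : Prop where
  far : ∀ i j, 1 ≤ i → i + 1 < j → j ≤ 8 → ⁅x i, x j⁆ = 0
  up : ∀ i, 1 ≤ i → i ≤ 7 → ⁅x i, ⁅x i, x (i + 1)⁆⁆ = -x (i + 1)
  down : ∀ i, 1 ≤ i → i ≤ 7 → ⁅x (i + 1), ⁅x (i + 1), x i⁆⁆ = -x i
  far_nine : ∀ i, 1 ≤ i → i ≤ 8 → i ≠ 3 → ⁅x 9, x i⁆ = 0
  up_nine : ⁅x 3, ⁅x 3, x 9⁆⁆ = -x 9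
  down_nine : ⁅x 9, ⁅x 9, x 3⁆⁆ = -x 3

/-- Expanding by the Jacobi identity in two ways gives both `[[e,a],[e,z]]` and its negative. The
lemma serves twice: for generators in the interior of a chain, and to show that `x_3` kills the
middle vector of the representations at node 0. -/
theorem lie_lie_lie_eq_zero {e a z : L} (ha : ⁅e, ⁅e, a⁆⁆ = -a) (hz : ⁅e, ⁅e, z⁆⁆ = -z)
    (haz : ⁅a, z⁆ = 0) : ⁅e, ⁅a, ⁅e, z⁆⁆⁆ = 0 := by
  have h1 : ⁅a, ⁅e, z⁆⁆ = -⁅⁅e, a⁆, z⁆ := by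
    have := leibniz_lie e a z
    rw [haz, lie_zero] at this
    exact eq_neg_of_add_eq_zero_right this.symm
  have h2 : ⁅e, ⁅a, ⁅e, z⁆⁆⁆ = -⁅⁅e, a⁆, ⁅e, z⁆⁆ := by
    rw [h1, lie_neg, leibniz_lie, ha, neg_lie, haz, neg_zero, zero_add]
  have h3 : ⁅e, ⁅a, ⁅e, z⁆⁆⁆ = ⁅⁅e, a⁆, ⁅e, z⁆⁆ := by
    rw [leibniz_lie, hz, lie_neg, haz, neg_zero, add_zero]
  have h4 : ⁅e, ⁅a, ⁅e, z⁆⁆⁆ + ⁅e, ⁅a, ⁅e, z⁆⁆⁆ = 0 := by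
    nth_rewrite 1 [h2]; rw [h3, neg_add_cancel]
  rw [← two_smul ℂ] at h4
  exact (smul_eq_zero.1 h4).resolve_left two_ne_zero

/-! ### Brackets of Berman generators with chains -/

theorem lie_chain_of_comm {y : L} {x : ℕ → L} (d : ℕ) : ∀ a,
    (∀ j, a ≤ j → j ≤ a + d → ⁅y, x j⁆ = 0) → ⁅y, chain x a d⁆ = 0 := by
  induction d with
  | zero => exact fun a h => h a le_rfl le_rfl
  | succ d ih =>
    intro a h
    rw [chain, leibniz_lie, h a le_rfl (by omega), zero_lie,
      ih (a + 1) fun j hj hj' => h j (by omega) (by omega), lie_zero, add_zero]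

namespace RelationsE9

variable {x : ℕ → L} (hx : RelationsE9 x)

include hx

theorem far' {i j : ℕ} (hi : 1 ≤ i) (hij : i + 1 < j) (hj : j ≤ 8) : ⁅x j, x i⁆ = 0 := by
  rw [← lie_skew, hx.far i j hi hij hj, neg_zero]

theorem lie_chain_left {i a d : ℕ} (hi : 1 ≤ i) (hia : i + 1 < a) (hd : a + d ≤ 8) :
    ⁅x i, chain x a d⁆ = 0 :=
  lie_chain_of_comm d a fun j hj hj' => hx.far i j hi (by omega) (by omega)

theorem lie_chain_right {i a d : ℕ} (ha : 1 ≤ a) (hia : a + d + 1 < i) (hi : i ≤ 8) :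
    ⁅x i, chain x a d⁆ = 0 :=
  lie_chain_of_comm d a fun j hj hj' => hx.far' (by omega) (by omega) hi

theorem lie_chain_succ (d : ℕ) : ∀ a, 1 ≤ a → a + d + 1 ≤ 8 →
    ⁅x (a + d + 1), chain x a d⁆ = -chain x a (d + 1) := by
  induction d with
  | zero => intro a _ _; exact (lie_skew _ _).symm
  | succ d ih =>
    intro a ha hd
    have := ih (a + 1) (by omega) (by omega)
    rw [show a + 1 + d + 1 = a + (d + 1) + 1 by ring] at this
    rw [chain, leibniz_lie, hx.far' ha (by omega) hd, zero_lie, zero_add, this, lie_neg]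
    rfl

theorem lie_chain_last (d : ℕ) : ∀ a, 1 ≤ a → a + d + 1 ≤ 8 →
    ⁅x (a + d + 1), chain x a (d + 1)⁆ = chain x a d := by
  induction d with
  | zero =>
    intro a ha hd
    change ⁅x (a + 1), ⁅x a, x (a + 1)⁆⁆ = x a
    rw [← lie_skew (x a), lie_neg, hx.down a ha (by omega), neg_neg]
  | succ d ih =>
    intro a ha hd
    have := ih (a + 1) (by omega) (by omega)
    rw [show a + 1 + d + 1 = a + (d + 1) + 1 by ring] at this
    rw [chain, leibniz_lie, hx.far' ha (by omega) hd, zero_lie, zero_add, this]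
    rfl

theorem lie_chain_first {a d : ℕ} (ha : 1 ≤ a) (hd : a + d + 1 ≤ 8) :
    ⁅x a, chain x a (d + 1)⁆ = -chain x (a + 1) d := by
  cases d with
  | zero => exact hx.up a ha (by omega)
  | succ d =>
    have h := hx.lie_chain_left (i := a) (a := a + 1 + 1) (d := d) ha (by omega) (by omega)
    change ⁅x a, ⁅x a, ⁅x (a + 1), chain x (a + 1 + 1) d⁆⁆⁆ = -⁅x (a + 1), chain x (a + 1 + 1) d⁆
    rw [leibniz_lie (x a) (x (a + 1)), h, lie_zero, add_zero, leibniz_lie, h, lie_zero, add_zero,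
      hx.up a ha (by omega), neg_lie]

/-- The analogue of `E_{i,i+1}` commuting with `E_{ab}` for disjoint indices. Interior positions
reduce to the second generator of a chain, where `lie_lie_lie_eq_zero` applies. -/
theorem lie_chain_inner (d : ℕ) : ∀ a i, 1 ≤ a → a < i → i < a + d → a + d ≤ 8 →
    ⁅x i, chain x a d⁆ = 0 := by
  induction d with
  | zero => intros; omega
  | succ d ih =>
    intro a i ha hai hi hd
    by_cases h : i = a + 1
    · subst h
      obtain ⟨d, rfl⟩ : ∃ d', d = d' + 1 := ⟨d - 1, by omega⟩
      exact lie_lie_lie_eq_zero (hx.down a ha (by omega))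
        (hx.lie_chain_first (a := a + 1) (by omega) (by omega))
        (hx.lie_chain_left ha (by omega) (by omega))
    · rw [chain, leibniz_lie, hx.far' ha (by omega) (by omega), zero_lie,
        ih (a + 1) i (by omega) (by omega) (by omega) (by omega), lie_zero, add_zero]

end RelationsE9

/-! ### The orthogonal Lie algebra generated by `x_1, …, x_8` -/

/-- The standard basis `E_{ab} - E_{ba}` of the orthogonal Lie algebra. -/
def skewBasis (x : ℕ → L) (a b : ℕ) : L :=
  if a < b then chain x a (b - 1 - a) else if b < a then -chain x b (a - 1 - b) else 0

theorem skewBasis_of_lt (x : ℕ → L) {a b : ℕ} (h : a < b) :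
    skewBasis x a b = chain x a (b - 1 - a) := if_pos h

theorem skewBasis_self (x : ℕ → L) (a : ℕ) : skewBasis x a a = 0 := by simp [skewBasis]

theorem skewBasis_swap (x : ℕ → L) (a b : ℕ) : skewBasis x a b = -skewBasis x b a := by
  rcases lt_trichotomy a b with h | rfl | h
  · simp [skewBasis, h, h.not_gt]
  · simp [skewBasis]
  · simp [skewBasis, h, h.not_gt]

/-- The commutator rule of `so(9)`, valid in any `L` with the relations: the chains need not be
linearly independent. -/
theorem RelationsE9.lie_skewBasis {x : ℕ → L} (hx : RelationsE9 x) {i a b : ℕ} (hi : 1 ≤ i)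
    (hi' : i ≤ 8) (ha : 1 ≤ a) (ha' : a ≤ 9) (hb : 1 ≤ b) (hb' : b ≤ 9) :
    ⁅x i, skewBasis x a b⁆ =
      ((if a = i + 1 then skewBasis x i b else 0) - if a = i then skewBasis x (i + 1) b else 0) +
      ((if b = i + 1 then skewBasis x a i else 0) - if b = i then skewBasis x a (i + 1) else 0) := by
  have key : ∀ a b, 1 ≤ a → a < b → b ≤ 9 → ⁅x i, skewBasis x a b⁆ =
      ((if a = i + 1 then skewBasis x i b else 0) - if a = i then skewBasis x (i + 1) b else 0) +
      ((if b = i + 1 then skewBasis x a i else 0) - if b = i then skewBasis x a (i + 1) else 0) := by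
    intro a b ha hab hb
    obtain ⟨d, rfl⟩ : ∃ d, b = a + d + 1 := ⟨b - 1 - a, by omega⟩
    have hY : skewBasis x a (a + d + 1) = chain x a d := by
      rw [skewBasis_of_lt x hab]; congr 1; omega
    rw [hY]
    rcases lt_trichotomy (i + 1) a with h | h | h
    · rw [hx.lie_chain_left hi h (by omega), if_neg (by omega), if_neg (by omega),
        if_neg (by omega), if_neg (by omega)]
      simp
    · subst h
      rw [if_pos rfl, if_neg (by omega), if_neg (by omega), if_neg (by omega),
        skewBasis_of_lt x (by omega), show i + 1 + d + 1 - 1 - i = d + 1 by omega]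
      simp [chain]
    · rcases eq_or_ne i a with rfl | hia
      · cases d with
        | zero => simp [chain, skewBasis_self]
        | succ d =>
          rw [hx.lie_chain_first hi (by omega), if_neg (by omega), if_pos rfl, if_neg (by omega),
            if_neg (by omega), skewBasis_of_lt x (by omega),
            show i + (d + 1) + 1 - 1 - (i + 1) = d by omega]
          simp
      · rw [if_neg (by omega), if_neg (by omega)]
        rcases lt_trichotomy i (a + d) with h' | rfl | h'
        · rw [hx.lie_chain_inner d a i ha (by omega) h' (by omega), if_neg (by omega),
            if_neg (by omega)]
          simp
        · obtain ⟨d, rfl⟩ : ∃ d', d = d' + 1 := ⟨d - 1, by omega⟩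
          have := hx.lie_chain_last d a ha (by omega)
          rw [← add_assoc, this, if_pos rfl, if_neg (by omega), skewBasis_of_lt x (by omega),
            show a + d + 1 - 1 - a = d by omega]
          simp
        · rw [if_neg (by omega)]
          rcases eq_or_ne i (a + d + 1) with rfl | hne
          · rw [hx.lie_chain_succ d a ha (by omega), if_pos rfl, skewBasis_of_lt x (by omega),
              show a + d + 1 + 1 - 1 - a = d + 1 by omega]
            simp
          · rw [hx.lie_chain_right ha (by omega) hi', if_neg (by omega)]
            simp
  rcases lt_trichotomy a b with h | rfl | h
  · exact key a b ha h hb'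
  · rw [skewBasis_self, lie_zero]
    split_ifs <;> simp [skewBasis_swap x a]
  · rw [skewBasis_swap x a b, lie_neg, key b a hb h ha', skewBasis_swap x i b,
      skewBasis_swap x (i + 1) b, skewBasis_swap x a i, skewBasis_swap x a (i + 1)]
    split_ifs <;> abel

/-- The linear map `Λ² ℂ⁹ → L` extending `e_a ∧ e_b ↦ E_{ab} - E_{ba}`. -/
def wedge (x : ℕ → L) : (Fin 9 → ℂ) →ₗ[ℂ] (Fin 9 → ℂ) →ₗ[ℂ] L :=
  LinearMap.mk₂ ℂ (fun u v => ∑ a : Fin 9, ∑ b : Fin 9, (u a * v b) • skewBasis x (a + 1) (b + 1))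
    (fun u u' v => by simp only [Pi.add_apply, add_mul, add_smul, Finset.sum_add_distrib])
    (fun c u v => by simp only [Pi.smul_apply, smul_eq_mul, Finset.smul_sum, mul_smul])
    (fun u v v' => by simp only [Pi.add_apply, mul_add, add_smul, Finset.sum_add_distrib])
    (fun c u v => by
      simp only [Pi.smul_apply, smul_eq_mul, Finset.smul_sum, smul_smul, mul_left_comm])

theorem wedge_single_single (x : ℕ → L) (a b : Fin 9) :
    wedge x (Pi.single a 1) (Pi.single b 1) = skewBasis x (a + 1) (b + 1) := by
  simp [wedge, LinearMap.mk₂_apply, Pi.single_apply, ite_smul, Finset.sum_ite_eq']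

theorem wedge_swap (x : ℕ → L) (u v : Fin 9 → ℂ) : wedge x u v = -wedge x v u := by
  have : wedge x = -(wedge x).flip := by
    refine (Pi.basisFun ℂ (Fin 9)).ext fun a => (Pi.basisFun ℂ (Fin 9)).ext fun b => ?_
    simp only [Pi.basisFun_apply, LinearMap.neg_apply, LinearMap.flip_apply, wedge_single_single]
    exact skewBasis_swap x _ _
  exact LinearMap.congr_fun₂ this u v

theorem wedge_self (x : ℕ → L) (u : Fin 9 → ℂ) : wedge x u u = 0 := by
  have := wedge_swap x u u
  rw [eq_neg_iff_add_eq_zero, ← two_smul ℂ] at this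
  exact (smul_eq_zero.1 this).resolve_left two_ne_zero

/-- The endomorphism `w ↦ (v·w) u - (u·w) v`. -/
def skewMap (u v : Fin 9 → ℂ) : Module.End ℂ (Fin 9 → ℂ) where
  toFun w := (v ⬝ᵥ w) • u - (u ⬝ᵥ w) • v
  map_add' w z := by simp only [dotProduct_add]; module
  map_smul' c w := by simp only [dotProduct_smul, smul_eq_mul, RingHom.id_apply]; module

theorem skewMap_apply (u v w : Fin 9 → ℂ) : skewMap u v w = (v ⬝ᵥ w) • u - (u ⬝ᵥ w) • v := rfl

theorem skewMap_swap (u v : Fin 9 → ℂ) : skewMap u v = -skewMap v u := by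
  refine LinearMap.ext fun w => ?_
  simp only [skewMap_apply, LinearMap.neg_apply, neg_sub]

theorem skewMap_self (u : Fin 9 → ℂ) : skewMap u u = 0 := by
  refine LinearMap.ext fun w => ?_
  simp only [skewMap_apply, LinearMap.zero_apply, sub_self]

/-- `y` acts on the image of `Λ² ℂ⁹` by the endomorphism `M` of `ℂ⁹`. -/
def ActsBy (x : ℕ → L) (y : L) (M : Module.End ℂ (Fin 9 → ℂ)) : Prop :=
  ∀ w z, ⁅y, wedge x w z⁆ = wedge x (M w) z + wedge x w (M z)

/-- Since chains are iterated brackets, the action of all of `so(9)` follows from that of the eight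
generators by computing commutators of matrices. -/
theorem ActsBy.lie {x : ℕ → L} {y y' : L} {M M' : Module.End ℂ (Fin 9 → ℂ)} (h : ActsBy x y M)
    (h' : ActsBy x y' M') : ActsBy x ⁅y, y'⁆ (M * M' - M' * M) := fun w z => by
  simp only [lie_lie, h w, h' w, lie_add, h _, h' _, LinearMap.sub_apply, Module.End.mul_apply,
    map_sub]
  abel

theorem ActsBy.neg {x : ℕ → L} {y : L} {M : Module.End ℂ (Fin 9 → ℂ)} (h : ActsBy x y M) :
    ActsBy x (-y) (-M) := fun w z => by
  simp only [neg_lie, h w z, LinearMap.neg_apply, map_neg, neg_add]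

theorem actsBy_of_basis {x : ℕ → L} {y : L} {M : Module.End ℂ (Fin 9 → ℂ)}
    (h : ∀ a b : Fin 9, ⁅y, skewBasis x (a + 1) (b + 1)⁆ =
      wedge x (M (Pi.single a 1)) (Pi.single b 1) + wedge x (Pi.single a 1) (M (Pi.single b 1))) :
    ActsBy x y M := by
  have : (wedge x).compr₂ (LieAlgebra.ad ℂ L y : L →ₗ[ℂ] L) =
      (wedge x).comp M + (wedge x).compl₂ M := by
    refine (Pi.basisFun ℂ (Fin 9)).ext fun a => (Pi.basisFun ℂ (Fin 9)).ext fun b => ?_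
    simp [wedge_single_single, h a b]
  exact fun w z => LinearMap.congr_fun₂ this w z

/-- The standard basis vector with label `k ∈ {1, …, 9}`. -/
def basisVec (k : ℕ) : Fin 9 → ℂ := Pi.single (Fin.ofNat 9 (k - 1)) 1

theorem basisVec_succ (a : Fin 9) : basisVec (a + 1) = Pi.single a 1 := by
  simp [basisVec]

theorem basisVec_dotProduct {a b : ℕ} (ha : 1 ≤ a) (ha' : a ≤ 9) (hb : 1 ≤ b) (hb' : b ≤ 9) :
    basisVec a ⬝ᵥ basisVec b = if a = b then 1 else 0 := by
  have : (Fin.ofNat 9 (a - 1) = Fin.ofNat 9 (b - 1)) ↔ a = b := by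
    simp only [Fin.ext_iff, Fin.val_ofNat]
    omega
  rw [basisVec, basisVec, single_one_dotProduct, Pi.single_apply]
  simp only [this]

theorem basisVec_induction {p : (Fin 9 → ℂ) → Prop} (hb : ∀ a, 1 ≤ a → a ≤ 9 → p (basisVec a))
    (h0 : p 0) (hadd : ∀ u v, p u → p v → p (u + v)) (hsmul : ∀ (c : ℂ) u, p u → p (c • u))
    (u : Fin 9 → ℂ) : p u := by
  refine Submodule.span_induction (p := fun u _ => p u) ?_ h0 (fun u v _ _ => hadd u v)
    (fun c u _ => hsmul c u) ((Pi.basisFun ℂ (Fin 9)).mem_span u)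
  rintro _ ⟨a, rfl⟩
  rw [Pi.basisFun_apply, ← basisVec_succ]
  exact hb _ (by omega) (by omega)

theorem wedge_basisVec (x : ℕ → L) {a b : ℕ} (ha : 1 ≤ a) (ha' : a ≤ 9) (hb : 1 ≤ b) (hb' : b ≤ 9) :
    wedge x (basisVec a) (basisVec b) = skewBasis x a b := by
  rw [basisVec, basisVec, wedge_single_single]
  simp only [Fin.val_ofNat]
  congr 1 <;> omega

namespace RelationsE9

variable {x : ℕ → L} (hx : RelationsE9 x)

include hx

theorem actsBy_gen {i : ℕ} (hi : 1 ≤ i) (hi' : i ≤ 8) :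
    ActsBy x (x i) (skewMap (basisVec i) (basisVec (i + 1))) := by
  refine actsBy_of_basis fun a b => ?_
  have ha := a.2
  have hb := b.2
  rw [hx.lie_skewBasis hi hi' (by omega) (by omega) (by omega) (by omega), ← basisVec_succ,
    ← basisVec_succ, skewMap_apply, skewMap_apply]
  simp only [map_sub, map_smul, LinearMap.sub_apply, LinearMap.smul_apply]
  rw [basisVec_dotProduct, basisVec_dotProduct, basisVec_dotProduct, basisVec_dotProduct,
    wedge_basisVec, wedge_basisVec, wedge_basisVec, wedge_basisVec]
  any_goals omega
  simp only [ite_smul, one_smul, zero_smul, eq_comm]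

theorem actsBy_chain (d : ℕ) : ∀ a, 1 ≤ a → a + d ≤ 8 →
    ActsBy x (chain x a d) (skewMap (basisVec a) (basisVec (a + d + 1))) := by
  induction d with
  | zero => exact fun a ha hd => hx.actsBy_gen ha hd
  | succ d ih =>
    intro a ha hd
    have h := (hx.actsBy_gen ha (by omega)).lie (ih (a + 1) (by omega) (by omega))
    suffices hM : skewMap (basisVec a) (basisVec (a + (d + 1) + 1)) =
        skewMap (basisVec a) (basisVec (a + 1)) * skewMap (basisVec (a + 1))
          (basisVec (a + 1 + d + 1)) - skewMap (basisVec (a + 1)) (basisVec (a + 1 + d + 1)) *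
          skewMap (basisVec a) (basisVec (a + 1)) by
      rw [hM]; exact h
    refine LinearMap.ext fun w => ?_
    simp only [LinearMap.sub_apply, Module.End.mul_apply, skewMap_apply, dotProduct_sub,
      dotProduct_smul, smul_eq_mul]
    rw [show a + 1 + d + 1 = a + (d + 1) + 1 by ring]
    simp only [basisVec_dotProduct, ha, show a ≤ 9 by omega, show 1 ≤ a + 1 by omega,
      show a + 1 ≤ 9 by omega, show 1 ≤ a + (d + 1) + 1 by omega,
      show a + (d + 1) + 1 ≤ 9 by omega, if_true]
    split_ifs <;> first | omega | module

theorem actsBy_wedge (u v : Fin 9 → ℂ) : ActsBy x (wedge x u v) (skewMap u v) := by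
  have key : ∀ a b, 1 ≤ a → a ≤ 9 → 1 ≤ b → b ≤ 9 →
      ActsBy x (skewBasis x a b) (skewMap (basisVec a) (basisVec b)) := by
    have lt : ∀ a b, 1 ≤ a → a < b → b ≤ 9 →
        ActsBy x (skewBasis x a b) (skewMap (basisVec a) (basisVec b)) := by
      intro a b ha hab hb
      have := hx.actsBy_chain (b - 1 - a) a ha (by omega)
      rwa [show a + (b - 1 - a) + 1 = b by omega, ← skewBasis_of_lt x hab] at this
    intro a b ha ha' hb hb'
    rcases lt_trichotomy a b with h | rfl | h
    · exact lt a b ha h hb'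
    · intro w z
      simp [skewBasis_self, skewMap_self]
    · rw [skewBasis_swap, skewMap_swap]
      exact (lt b a hb h ha').neg
  intro w z
  induction u using basisVec_induction with
  | h0 => simp [skewMap_apply]
  | hadd u u' h h' =>
    simp only [map_add, LinearMap.add_apply, add_lie, h, h', skewMap_apply, add_dotProduct,
      map_sub, map_smul, LinearMap.sub_apply, LinearMap.smul_apply]
    module
  | hsmul c u h =>
    simp only [LinearMap.smul_apply, smul_lie, h, skewMap_apply, smul_dotProduct,
      map_sub, map_smul, LinearMap.sub_apply, smul_eq_mul]
    module
  | hb a ha ha' =>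
    induction v using basisVec_induction with
    | h0 => simp [skewMap_apply]
    | hadd u u' h h' =>
      simp only [map_add, LinearMap.add_apply, add_lie, h, h', skewMap_apply, add_dotProduct,
        map_sub, map_smul, LinearMap.sub_apply, LinearMap.smul_apply]
      module
    | hsmul c u h =>
      simp only [LinearMap.smul_apply, smul_lie, h, skewMap_apply, smul_dotProduct,
        map_sub, map_smul, LinearMap.sub_apply, smul_eq_mul]
      module
    | hb b hb hb' => rw [wedge_basisVec x ha ha' hb hb']; exact key a b ha ha' hb hb' w z

/-- This reduces every bracket inside the subalgebra generated by `x_1, …, x_8` to dot products in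
`ℂ⁹`. -/
theorem lie_wedge_wedge (u v w z : Fin 9 → ℂ) : ⁅wedge x u v, wedge x w z⁆ =
    (v ⬝ᵥ w) • wedge x u z - (u ⬝ᵥ w) • wedge x v z +
      ((v ⬝ᵥ z) • wedge x w u - (u ⬝ᵥ z) • wedge x w v) := by
  rw [hx.actsBy_wedge u v w z]
  simp only [skewMap_apply, map_sub, map_smul, LinearMap.sub_apply, LinearMap.smul_apply]

end RelationsE9

/-! ### Root vectors -/

/-- A basis of `ℂ⁹` of weight vectors: `weightVec (± k)` has weight `± L_k`. -/
def weightVec (k : ℤ) : Fin 9 → ℂ :=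
  if k = 0 then basisVec 9
  else basisVec (2 * k.natAbs) - ((k.sign : ℂ) * Complex.I) • basisVec (2 * k.natAbs - 1)

theorem weightVec_zero : weightVec 0 = basisVec 9 := if_pos rfl

theorem weightVec_mul {k : ℕ} (hk : 1 ≤ k) (s : ℤˣ) : weightVec ((s : ℤ) * k) =
    basisVec (2 * k) - (((s : ℤ) : ℂ) * Complex.I) • basisVec (2 * k - 1) := by
  have hk0 : k ≠ 0 := by omega
  have : (k : ℤ).sign = 1 := Int.sign_eq_one_of_pos (by omega)
  rcases Int.units_eq_one_or s with rfl | rfl <;> simp [weightVec, hk0, Int.sign_neg, this]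

theorem weightVec_cases {k : ℤ} (hk : k.natAbs ≤ 4) :
    k = 0 ∨ ∃ (s : ℤˣ) (n : ℕ), 1 ≤ n ∧ n ≤ 4 ∧ k = s * n := by
  rcases lt_trichotomy k 0 with h | h | h
  · exact Or.inr ⟨-1, k.natAbs, by omega, hk, by rw [Units.val_neg, Units.val_one]; omega⟩
  · exact Or.inl h
  · exact Or.inr ⟨1, k.natAbs, by omega, hk, by rw [Units.val_one]; omega⟩

/-- A Witt basis: for `k ≠ 0` the vector `w_k` is isotropic and pairs only with `w_{-k}`, with value
`1 + 1`, whereas `w_0 = e_9` is a unit vector. -/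
theorem weightVec_dotProduct {a b : ℤ} (ha : a.natAbs ≤ 4) (hb : b.natAbs ≤ 4) :
    weightVec a ⬝ᵥ weightVec b = if a + b = 0 then (if a = 0 then 1 else 2) else 0 := by
  rcases weightVec_cases ha with rfl | ⟨s, n, hn, hn', rfl⟩ <;>
    rcases weightVec_cases hb with rfl | ⟨t, m, hm, hm', rfl⟩
  · simp [weightVec_zero, basisVec_dotProduct]
  · have : (t : ℤ) * m ≠ 0 := by
      rcases Int.units_eq_one_or t with rfl | rfl <;> simp <;> omega
    rw [weightVec_zero, weightVec_mul hm, dotProduct_sub, dotProduct_smul, basisVec_dotProduct,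
      basisVec_dotProduct, if_neg (by omega), if_neg (by omega), if_neg (by omega)]
    any_goals omega
    simp
  · have : (s : ℤ) * n ≠ 0 := by
      rcases Int.units_eq_one_or s with rfl | rfl <;> simp <;> omega
    rw [weightVec_zero, weightVec_mul hn, sub_dotProduct, smul_dotProduct, basisVec_dotProduct,
      basisVec_dotProduct, if_neg (by omega), if_neg (by omega), if_neg (by omega)]
    any_goals omega
    simp
  · rw [weightVec_mul hm, weightVec_mul hn]
    simp only [sub_dotProduct, dotProduct_sub, smul_dotProduct, dotProduct_smul]
    rw [basisVec_dotProduct, basisVec_dotProduct, basisVec_dotProduct, basisVec_dotProduct]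
    any_goals omega
    rw [if_neg (show 2 * n ≠ 2 * m - 1 by omega), if_neg (show 2 * n - 1 ≠ 2 * m by omega)]
    by_cases h : n = m
    · subst h
      rcases Int.units_eq_one_or s with rfl | rfl <;> rcases Int.units_eq_one_or t with rfl | rfl
      all_goals simp [← two_mul]
      all_goals omega
    · rw [if_neg (by omega), if_neg (by omega), if_neg]
      · simp
      · rcases Int.units_eq_one_or s with rfl | rfl <;> rcases Int.units_eq_one_or t with rfl | rfl
        all_goals simp
        all_goals omega

theorem basisVec_even {k : ℕ} (hk : 1 ≤ k) :
    basisVec (2 * k) = (1 / 2 : ℂ) • (weightVec k + weightVec (-k)) := by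
  have h1 := weightVec_mul hk 1
  have h2 := weightVec_mul hk (-1)
  simp only [Units.val_one, Units.val_neg, Int.cast_one, Int.cast_neg, one_mul, neg_mul] at h1 h2
  rw [h1, h2]
  module

theorem basisVec_odd {k : ℕ} (hk : 1 ≤ k) :
    basisVec (2 * k - 1) = (Complex.I / 2) • (weightVec k - weightVec (-k)) := by
  have h1 := weightVec_mul hk 1
  have h2 := weightVec_mul hk (-1)
  simp only [Units.val_one, Units.val_neg, Int.cast_one, Int.cast_neg, one_mul, neg_mul] at h1 h2
  rw [h1, h2]
  have : Complex.I * Complex.I = -1 := Complex.I_mul_I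
  match_scalars
  · linear_combination this
  · ring

theorem wedge_basisVec_of_lt (x : ℕ → L) {a b : ℕ} (ha : 1 ≤ a) (h : a < b) (hb : b ≤ 9) :
    wedge x (basisVec a) (basisVec b) = chain x a (b - 1 - a) := by
  rw [wedge_basisVec x ha (by omega) (by omega) hb, skewBasis_of_lt x h]

theorem longRootVec_eq (x : ℕ → L) (s t : ℤˣ) {i j : ℕ} (hi : 1 ≤ i) (hij : i < j) (hj : j ≤ 4) :
    longRootVec x ((s : ℤ) : ℂ) ((t : ℤ) : ℂ) i j =
      (Complex.I / 2) • wedge x (weightVec (s * i)) (weightVec (t * j)) := by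
  rw [weightVec_mul hi, weightVec_mul (by omega), longRootVec]
  simp only [map_sub, map_smul, LinearMap.sub_apply, LinearMap.smul_apply]
  rw [wedge_basisVec_of_lt, wedge_basisVec_of_lt, wedge_basisVec_of_lt, wedge_basisVec_of_lt]
  any_goals omega
  rw [chainTo, chainTo, chainTo, chainTo, show 2 * j - 1 - 1 - 2 * i = 2 * j - 2 - 2 * i by omega,
    show 2 * j - 1 - 1 - (2 * i - 1) = 2 * j - 2 - (2 * i - 1) by omega]
  have : Complex.I * Complex.I = -1 := Complex.I_mul_I
  congr 1
  match_scalars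
  · ring
  · ring
  · ring
  · linear_combination (-(s : ℤ) * (t : ℤ) : ℂ) * this

theorem shortRootVec_eq (x : ℕ → L) (s : ℤˣ) : shortRootVec x ((s : ℤ) : ℂ) =
    Complex.I • wedge x (weightVec (s * 4)) (weightVec 0) := by
  have h := weightVec_mul (k := 4) (by norm_num) s
  push_cast at h
  rw [h, weightVec_zero]
  simp only [map_sub, map_smul, LinearMap.sub_apply, LinearMap.smul_apply]
  rw [wedge_basisVec_of_lt, wedge_basisVec_of_lt] <;> try norm_num
  rfl

theorem cartanH_eq (x : ℕ → L) {k : ℕ} (hk : 1 ≤ k) (hk' : k ≤ 4) :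
    cartanH x k = (1 / 2 : ℂ) • wedge x (weightVec k) (weightVec (-k)) := by
  have h1 := weightVec_mul hk 1
  have h2 := weightVec_mul hk (-1)
  simp only [Units.val_one, Units.val_neg, Int.cast_one, Int.cast_neg, one_mul, neg_mul] at h1 h2
  rw [h1, h2]
  simp only [map_sub, map_smul, LinearMap.sub_apply, LinearMap.smul_apply, wedge_self]
  rw [wedge_swap x (basisVec (2 * k)), wedge_basisVec_of_lt] <;> try omega
  rw [show 2 * k - 1 - (2 * k - 1) = 0 by omega, chain, cartanH]
  module

/-- The vector `x_ε` for a sign `ε`. -/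
def xSigned (x : ℕ → L) (s : ℤˣ) : L :=
  Complex.I • (x 9 - (((s : ℤ) : ℂ) * Complex.I) • ⁅x 3, x 9⁆)

/-- The images of the generators `e_{s α_i}`. -/
def rootVec (x : ℕ → L) (i : Fin 5) (s : ℤˣ) : L :=
  ![xSigned x s,
    (Complex.I / 2) • wedge x (weightVec (s * 1)) (weightVec (-s * 2)),
    (Complex.I / 2) • wedge x (weightVec (s * 2)) (weightVec (-s * 3)),
    (Complex.I / 2) • wedge x (weightVec (s * 3)) (weightVec (-s * 4)),
    Complex.I • wedge x (weightVec (s * 4)) (weightVec 0)] i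

theorem rootVec_zero_one (x : ℕ → L) : rootVec x 0 1 = xPlus x := by
  simp [rootVec, xSigned, xPlus]

theorem rootVec_zero_neg_one (x : ℕ → L) : rootVec x 0 (-1) = xMinus x := by
  simp [rootVec, xSigned, xMinus]

theorem rootVec_one (x : ℕ → L) {i : Fin 5} (hi : i ≠ 0) : rootVec x i 1 = soE x i := by
  have h1 := longRootVec_eq x 1 (-1) (i := 1) (j := 2) (by norm_num) (by norm_num) (by norm_num)
  have h2 := longRootVec_eq x 1 (-1) (i := 2) (j := 3) (by norm_num) (by norm_num) (by norm_num)
  have h3 := longRootVec_eq x 1 (-1) (i := 3) (j := 4) (by norm_num) (by norm_num) (by norm_num)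
  have h4 := shortRootVec_eq x 1
  fin_cases i
  · exact absurd rfl hi
  all_goals simp_all [rootVec, soE]

theorem rootVec_neg_one (x : ℕ → L) {i : Fin 5} (hi : i ≠ 0) : rootVec x i (-1) = soF x i := by
  have h1 := longRootVec_eq x (-1) 1 (i := 1) (j := 2) (by norm_num) (by norm_num) (by norm_num)
  have h2 := longRootVec_eq x (-1) 1 (i := 2) (j := 3) (by norm_num) (by norm_num) (by norm_num)
  have h3 := longRootVec_eq x (-1) 1 (i := 3) (j := 4) (by norm_num) (by norm_num) (by norm_num)
  have h4 := shortRootVec_eq x (-1)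
  fin_cases i
  · exact absurd rfl hi
  all_goals simp_all [rootVec, soF]

namespace RelationsE9

variable {x : ℕ → L} (hx : RelationsE9 x)

include hx

theorem lie_wedge_weightVec {a b c d : ℤ} (ha : a.natAbs ≤ 4) (hb : b.natAbs ≤ 4)
    (hc : c.natAbs ≤ 4) (hd : d.natAbs ≤ 4) :
    ⁅wedge x (weightVec a) (weightVec b), wedge x (weightVec c) (weightVec d)⁆ =
      (if b + c = 0 then (if b = 0 then (1 : ℂ) else 2) else 0) •
        wedge x (weightVec a) (weightVec d) -
      (if a + c = 0 then (if a = 0 then (1 : ℂ) else 2) else 0) •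
        wedge x (weightVec b) (weightVec d) +
      ((if b + d = 0 then (if b = 0 then (1 : ℂ) else 2) else 0) •
        wedge x (weightVec c) (weightVec a) -
      (if a + d = 0 then (if a = 0 then (1 : ℂ) else 2) else 0) •
        wedge x (weightVec c) (weightVec b)) := by
  rw [hx.lie_wedge_wedge, weightVec_dotProduct hb hc, weightVec_dotProduct ha hc,
    weightVec_dotProduct hb hd, weightVec_dotProduct ha hd]

/-- Nodes 1 to 4 span the Cartan matrix of `B_4`. Each relation says that a root string of `so(9)`
ends, and is checked on dot products of weight vectors. -/
theorem serre_rootVec {i j : Fin 5} (hi : i ≠ 0) (hj : j ≠ 0) (s t : ℤˣ)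
    (hne : ¬ (i = j ∧ s = -t)) :
    ((LieAlgebra.ad ℂ L (rootVec x i s)) ^
      (max 1 (1 - (s : ℤ) * (t : ℤ) * gimB4Diamond i j)).toNat) (rootVec x j t) = 0 := by
  have key := @lie_wedge_weightVec _ _ _ _ hx
  rcases Int.units_eq_one_or s with rfl | rfl <;> rcases Int.units_eq_one_or t with rfl | rfl <;>
  fin_cases i <;> fin_cases j <;>
  first
  | exact absurd rfl hi
  | exact absurd rfl hj
  | exact absurd ⟨rfl, rfl⟩ hne
  | (simp [rootVec, gimB4Diamond, pow_succ, LieAlgebra.ad_apply]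
     try simp (disch := decide) [key, wedge_self])

end RelationsE9
/-- The `L_k`-component of the weight of `rootVec x i 1`. -/
def rootWeight : Matrix (Fin 5) (Fin 4) ℤ :=
  !![0, 1, 0, 0; 1, -1, 0, 0; 0, 1, -1, 0; 0, 0, 1, -1; 0, 0, 0, 1]

/-! ### The `so(3)` at node 0 and its three-dimensional representations -/

section

variable {e a z : L} (ha : ⁅e, ⁅e, a⁆⁆ = -a) (ha' : ⁅a, ⁅a, e⁆⁆ = -e) (hz : ⁅e, ⁅e, z⁆⁆ = -z)
  (haz : ⁅a, z⁆ = 0) (s : ℤˣ)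

include ha ha' hz haz

/-- Here `e = x_3` and `a = x_9`. For `d = ±1` the vector `z - d i [e,z]` has weight `d` under `-i
e`, and `[a,[e,z]]` has weight 0. The operator of sign `s` therefore kills the extreme vector with
`d = s` and sends the opposite one to a multiple of the middle. -/
theorem lie_xSigned_vector (d : ℂ) :
    ⁅Complex.I • (a - (((s : ℤ) : ℂ) * Complex.I) • ⁅e, a⁆), z - (d * Complex.I) • ⁅e, z⁆⁆ =
      (d - ((s : ℤ) : ℂ)) • ⁅a, ⁅e, z⁆⁆ := by
  have h1 : ⁅⁅e, a⁆, z⁆ = -⁅a, ⁅e, z⁆⁆ := by rw [lie_lie, haz, lie_zero, zero_sub]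
  have h2 : ⁅⁅e, a⁆, ⁅e, z⁆⁆ = 0 := by
    rw [lie_lie, lie_lie_lie_eq_zero ha hz haz, hz, lie_neg, haz, neg_zero, sub_zero]
  simp only [smul_lie, sub_lie, lie_sub, lie_smul, h1, h2, haz]
  have : Complex.I * Complex.I = -1 := Complex.I_mul_I
  match_scalars
  linear_combination (((s : ℤ) : ℂ) - d) * this

/-- The second half of the string: the middle vector goes to the extreme vector of weight `s`. -/
theorem lie_xSigned_lie_lie :
    ⁅Complex.I • (a - (((s : ℤ) : ℂ) * Complex.I) • ⁅e, a⁆), ⁅a, ⁅e, z⁆⁆⁆ =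
      ((s : ℤ) : ℂ) • (z - (((s : ℤ) : ℂ) * Complex.I) • ⁅e, z⁆) := by
  have h0 : ⁅e, ⁅a, ⁅e, z⁆⁆⁆ = 0 := lie_lie_lie_eq_zero ha hz haz
  have h1 : ⁅a, ⁅a, ⁅e, z⁆⁆⁆ = -⁅e, z⁆ := by
    have h := leibniz_lie a e z
    rw [haz, lie_zero, add_zero] at h
    rw [h, leibniz_lie, haz, lie_zero, add_zero, ha', neg_lie]
  have h2 : ⁅⁅e, a⁆, ⁅a, ⁅e, z⁆⁆⁆ = z := by
    rw [lie_lie, h0, h1, lie_zero, lie_neg, hz, neg_neg, sub_zero]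
  have hs : ((s : ℤ) : ℂ) * ((s : ℤ) : ℂ) = 1 := by exact_mod_cast Int.units_coe_mul_self s
  have : Complex.I * Complex.I = -1 := Complex.I_mul_I
  simp only [smul_lie, sub_lie, h1, h2]
  match_scalars
  · linear_combination Complex.I * hs
  · linear_combination -((s : ℤ) : ℂ) * this

/-- One bracket gives a multiple of the middle vector `[a,[e,z]]`, which commutes with both `z` and
`[e,z]` as soon as `[z,[e,z]] = 0`. -/
theorem lie_vector_lie_vector_xSigned (hzz : ⁅z, ⁅e, z⁆⁆ = 0) (d : ℂ) :
    ⁅z - (d * Complex.I) • ⁅e, z⁆, ⁅z - (d * Complex.I) • ⁅e, z⁆,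
      Complex.I • (a - (((s : ℤ) : ℂ) * Complex.I) • ⁅e, a⁆)⁆⁆ = 0 := by
  have h1 : ⁅z, ⁅a, ⁅e, z⁆⁆⁆ = 0 := by
    rw [leibniz_lie, hzz, lie_zero, add_zero, ← lie_skew z a, haz, neg_zero, zero_lie]
  have h2 : ⁅⁅e, z⁆, ⁅a, ⁅e, z⁆⁆⁆ = 0 := by
    rw [lie_lie, h1, lie_zero, lie_lie_lie_eq_zero ha hz haz, lie_zero, sub_zero]
  rw [← lie_skew _ (Complex.I • _), lie_xSigned_vector ha ha' hz haz, lie_neg, lie_smul, sub_lie,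
    smul_lie, h1, h2, smul_zero, sub_zero, smul_zero, neg_zero]

end

namespace RelationsE9

variable {x : ℕ → L} (hx : RelationsE9 x)

include hx

theorem wedge_three_four : x 3 = wedge x (basisVec 3) (basisVec 4) := by
  rw [wedge_basisVec_of_lt x (by norm_num) (by norm_num) (by norm_num)]; rfl

/-- Such a chain omits `x_3`, the only neighbour of `x_9`. -/
theorem lie_nine_wedge {a b : ℕ} (ha : 1 ≤ a) (hb : b ≤ 9) (hab : a < b) (h : b ≤ 3 ∨ 4 ≤ a) :
    ⁅x 9, wedge x (basisVec a) (basisVec b)⁆ = 0 := by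
  rw [wedge_basisVec_of_lt x ha hab hb]
  exact lie_chain_of_comm _ _ fun j hj hj' =>
    hx.far_nine j (by omega) (by omega) (by omega)

theorem lie_nine_wedge_low (u : ℤˣ) :
    ⁅x 9, wedge x (weightVec u) (basisVec 3)⁆ = 0 := by
  have h := weightVec_mul (k := 1) (by norm_num) u
  rw [Nat.cast_one, mul_one] at h
  rw [h]
  simp only [map_sub, map_smul, LinearMap.sub_apply, LinearMap.smul_apply, lie_sub, lie_smul]
  rw [hx.lie_nine_wedge, hx.lie_nine_wedge] <;> simp

theorem lie_nine_wedge_high (u : ℤˣ) :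
    ⁅x 9, wedge x (basisVec 4) (weightVec (u * 3))⁆ = 0 := by
  have h := weightVec_mul (k := 3) (by norm_num) u
  push_cast at h
  rw [h]
  simp only [map_sub, map_smul, lie_sub, lie_smul]
  rw [hx.lie_nine_wedge, hx.lie_nine_wedge] <;> simp

theorem exists_weightVec_eq {a : ℤ} (ha : a.natAbs ≤ 4) (ha' : a = 0 ∨ 3 ≤ a.natAbs) :
    ∃ (m n : ℕ) (c : ℂ), 5 ≤ m ∧ m ≤ 9 ∧ 5 ≤ n ∧ n ≤ 9 ∧
      weightVec a = basisVec m - c • basisVec n := by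
  rcases weightVec_cases ha with rfl | ⟨s, k, hk, hk', rfl⟩
  · exact ⟨9, 9, 0, by norm_num, by norm_num, by norm_num, by norm_num, by simp [weightVec_zero]⟩
  · have : 3 ≤ k := by
      rcases Int.units_eq_one_or s with rfl | rfl
      all_goals simp at ha'
      all_goals omega
    exact ⟨2 * k, 2 * k - 1, _, by omega, by omega, by omega, by omega, weightVec_mul hk s⟩

theorem lie_nine_wedge_of_four_le {a b : ℕ} (ha : 4 ≤ a) (ha' : a ≤ 9) (hb : 4 ≤ b) (hb' : b ≤ 9) :
    ⁅x 9, wedge x (basisVec a) (basisVec b)⁆ = 0 := by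
  rcases lt_trichotomy a b with h | rfl | h
  · exact hx.lie_nine_wedge (by omega) hb' h (Or.inr ha)
  · rw [wedge_self, lie_zero]
  · rw [wedge_swap, lie_neg, hx.lie_nine_wedge (by omega) ha' h (Or.inr hb), neg_zero]

theorem lie_three_wedge_of_five_le {a b : ℕ} (ha : 5 ≤ a) (ha' : a ≤ 9) (hb : 5 ≤ b) (hb' : b ≤ 9) :
    ⁅x 3, wedge x (basisVec a) (basisVec b)⁆ = 0 := by
  rw [hx.wedge_three_four, hx.lie_wedge_wedge, basisVec_dotProduct, basisVec_dotProduct,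
    basisVec_dotProduct, basisVec_dotProduct]
  any_goals omega
  rw [if_neg (by omega), if_neg (by omega), if_neg (by omega), if_neg (by omega)]
  simp

/-- The weight vectors with index 0, ±3, ±4 involve only `e_5, …, e_9`. Their wedges lie in the
`so(5)` of `x_5, …, x_8`, which commutes with `x_3` and `x_9`. -/
theorem lie_xSigned_high (s : ℤˣ) {a b : ℤ} (ha : a.natAbs ≤ 4) (hb : b.natAbs ≤ 4)
    (ha' : a = 0 ∨ 3 ≤ a.natAbs) (hb' : b = 0 ∨ 3 ≤ b.natAbs) :
    ⁅xSigned x s, wedge x (weightVec a) (weightVec b)⁆ = 0 := by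
  obtain ⟨m, n, c, hm, hm', hn, hn', h⟩ := hx.exists_weightVec_eq ha ha'
  obtain ⟨m₁, n₁, c₁, hm₁, hm₁', hn₁, hn₁', h₁⟩ := hx.exists_weightVec_eq hb hb'
  have key : ∀ k l : ℕ, 5 ≤ k → k ≤ 9 → 5 ≤ l → l ≤ 9 →
      ⁅xSigned x s, wedge x (basisVec k) (basisVec l)⁆ = 0 := by
    intro k l hk hk' hl hl'
    rw [xSigned, smul_lie, sub_lie, smul_lie, lie_lie,
      hx.lie_nine_wedge_of_four_le (by omega) hk' (by omega) hl',
      hx.lie_three_wedge_of_five_le hk hk' hl hl']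
    simp
  rw [h, h₁]
  simp only [map_sub, map_smul, LinearMap.sub_apply, LinearMap.smul_apply, lie_sub, lie_smul]
  rw [key, key, key, key] <;> first | assumption | simp

theorem weightVec_two_mul (t : ℤˣ) :
    weightVec ((t : ℤ) * 2) = basisVec 4 - (((t : ℤ) : ℂ) * Complex.I) • basisVec 3 := by
  exact_mod_cast weightVec_mul (k := 2) (by norm_num) t

section

variable {p : Fin 9 → ℂ} (h3 : basisVec 3 ⬝ᵥ p = 0) (h4 : basisVec 4 ⬝ᵥ p = 0)

include h3 h4

theorem lie_three_wedge_three : ⁅x 3, wedge x p (basisVec 3)⁆ = -wedge x p (basisVec 4) := by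
  rw [hx.wedge_three_four, hx.lie_wedge_wedge, h3, h4, basisVec_dotProduct, basisVec_dotProduct] <;>
  simp

theorem lie_three_wedge_four : ⁅x 3, wedge x p (basisVec 4)⁆ = wedge x p (basisVec 3) := by
  rw [hx.wedge_three_four, hx.lie_wedge_wedge, h3, h4, basisVec_dotProduct, basisVec_dotProduct] <;>
  simp

theorem lie_wedge_three_wedge_four (hp : p ⬝ᵥ p = 0) :
    ⁅wedge x p (basisVec 3), wedge x p (basisVec 4)⁆ = 0 := by
  rw [hx.lie_wedge_wedge, h3, hp, dotProduct_comm p, h4, basisVec_dotProduct] <;> simp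

end

/-- The vectors `p` for which `p ∧ weightVec (± 2)` lies in a three-dimensional representation of the
subalgebra generated by `x_3` and `x_9`. -/
def IsVector (x : ℕ → L) (p : Fin 9 → ℂ) : Prop :=
  ∃ z : L, ⁅x 3, ⁅x 3, z⁆⁆ = -z ∧ ⁅x 9, z⁆ = 0 ∧ ⁅z, ⁅x 3, z⁆⁆ = 0 ∧
    ∀ t : ℤˣ, ∃ c : ℂ, wedge x p (weightVec ((t : ℤ) * 2)) =
      c • (z - (((t : ℤ) : ℂ) * Complex.I) • ⁅x 3, z⁆)

/-- The choice `z = w_u ∧ e_3` is dictated by `[x_9, z] = 0`: it involves `x_1` and `x_2` only.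
Isotropy of `w_u` gives `[z, [x_3, z]] = 0`. -/
theorem low_vector (u : ℤˣ) :
    let z := wedge x (weightVec u) (basisVec 3)
    ⁅x 3, ⁅x 3, z⁆⁆ = -z ∧ ⁅x 9, z⁆ = 0 ∧ ⁅z, ⁅x 3, z⁆⁆ = 0 ∧
      ∀ t : ℤˣ, wedge x (weightVec u) (weightVec ((t : ℤ) * 2)) =
        (-(((t : ℤ) : ℂ) * Complex.I)) • (z - (((t : ℤ) : ℂ) * Complex.I) • ⁅x 3, z⁆) := by
  have h := weightVec_mul (k := 1) (by norm_num) u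
  rw [Nat.cast_one, mul_one] at h
  have h3 : basisVec 3 ⬝ᵥ weightVec u = 0 := by
    rw [h, dotProduct_sub, dotProduct_smul, basisVec_dotProduct, basisVec_dotProduct] <;> simp
  have h4 : basisVec 4 ⬝ᵥ weightVec u = 0 := by
    rw [h, dotProduct_sub, dotProduct_smul, basisVec_dotProduct, basisVec_dotProduct] <;> simp
  have hp : weightVec u ⬝ᵥ weightVec u = 0 := by
    rcases Int.units_eq_one_or u with rfl | rfl <;>
    rw [weightVec_dotProduct] <;> simp
  refine ⟨?_, hx.lie_nine_wedge_low u, ?_, fun t => ?_⟩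
  · rw [hx.lie_three_wedge_three h3 h4, lie_neg, hx.lie_three_wedge_four h3 h4]
  · rw [hx.lie_three_wedge_three h3 h4, lie_neg, hx.lie_wedge_three_wedge_four h3 h4 hp, neg_zero]
  · rw [hx.lie_three_wedge_three h3 h4, hx.weightVec_two_mul, map_sub, map_smul]
    have : Complex.I * Complex.I = -1 := Complex.I_mul_I
    have hs : ((t : ℤ) : ℂ) * ((t : ℤ) : ℂ) = 1 := by exact_mod_cast Int.units_coe_mul_self t
    match_scalars
    · linear_combination ((t : ℤ) : ℂ) * ((t : ℤ) : ℂ) * this - hs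
    · ring

theorem isVector_low (u : ℤˣ) : IsVector x (weightVec u) :=
  have ⟨h1, h2, h3, h4⟩ := hx.low_vector u
  ⟨_, h1, h2, h3, fun t => ⟨_, h4 t⟩⟩

theorem isVector_high (u : ℤˣ) : IsVector x (weightVec ((u : ℤ) * 3)) := by
  have h := weightVec_mul (k := 3) (by norm_num) u
  push_cast at h
  have h3 : basisVec 3 ⬝ᵥ weightVec ((u : ℤ) * 3) = 0 := by
    rw [h, dotProduct_sub, dotProduct_smul, basisVec_dotProduct, basisVec_dotProduct] <;> simp
  have h4 : basisVec 4 ⬝ᵥ weightVec ((u : ℤ) * 3) = 0 := by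
    rw [h, dotProduct_sub, dotProduct_smul, basisVec_dotProduct, basisVec_dotProduct] <;> simp
  have hp : weightVec ((u : ℤ) * 3) ⬝ᵥ weightVec ((u : ℤ) * 3) = 0 := by
    rcases Int.units_eq_one_or u with rfl | rfl <;>
    rw [weightVec_dotProduct] <;> simp
  -- On this side of node 3 the vector killed by `x_9` uses `e_4` instead of `e_3`: it involves
  -- `x_4` and `x_5` only.
  refine ⟨wedge x (weightVec ((u : ℤ) * 3)) (basisVec 4), ?_, ?_, ?_, fun t => ?_⟩
  · rw [hx.lie_three_wedge_four h3 h4, hx.lie_three_wedge_three h3 h4]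
  · rw [wedge_swap, lie_neg, hx.lie_nine_wedge_high, neg_zero]
  · rw [hx.lie_three_wedge_four h3 h4, ← lie_skew, hx.lie_wedge_three_wedge_four h3 h4 hp, neg_zero]
  · refine ⟨1, ?_⟩
    rw [hx.lie_three_wedge_four h3 h4, hx.weightVec_two_mul, map_sub, map_smul, one_smul]

theorem lie_xSigned_wedge_same {p : Fin 9 → ℂ} (hp : IsVector x p) (s : ℤˣ) :
    ⁅xSigned x s, wedge x p (weightVec ((s : ℤ) * 2))⁆ = 0 := by
  obtain ⟨z, hz, haz, -, h⟩ := hp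
  obtain ⟨c, hc⟩ := h s
  rw [hc, lie_smul, xSigned, lie_xSigned_vector hx.up_nine hx.down_nine hz haz, sub_self, zero_smul,
    smul_zero]

theorem lie_xSigned_pow_three {p : Fin 9 → ℂ} (hp : IsVector x p) (s : ℤˣ) :
    ⁅xSigned x s, ⁅xSigned x s, ⁅xSigned x s, wedge x p (weightVec (-(s : ℤ) * 2))⁆⁆⁆ = 0 := by
  obtain ⟨z, hz, haz, -, h⟩ := hp
  obtain ⟨c, hc⟩ := h (-s)
  rw [Units.val_neg] at hc
  simp only [hc, lie_smul, xSigned, lie_xSigned_vector hx.up_nine hx.down_nine hz haz,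
    lie_xSigned_lie_lie hx.up_nine hx.down_nine hz haz, sub_self, zero_smul, smul_zero]

theorem lie_wedge_lie_wedge_xSigned {p : Fin 9 → ℂ} (hp : IsVector x p) (s t : ℤˣ) :
    ⁅wedge x p (weightVec ((t : ℤ) * 2)), ⁅wedge x p (weightVec ((t : ℤ) * 2)), xSigned x s⁆⁆ = 0 := by
  obtain ⟨z, hz, haz, hzz, h⟩ := hp
  obtain ⟨c, hc⟩ := h t
  rw [hc, smul_lie, smul_lie, lie_smul, xSigned,
    lie_vector_lie_vector_xSigned hx.up_nine hx.down_nine hz haz s hzz, smul_zero, smul_zero]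

theorem lie_xSigned_xSigned (s : ℤˣ) :
    ⁅xSigned x s, xSigned x (-s)⁆ = ((s : ℤ) : ℂ) • (2 : ℂ) • cartanH x 2 := by
  have h : ⁅x 9, ⁅x 3, x 9⁆⁆ = x 3 := by rw [← lie_skew (x 3), lie_neg, hx.down_nine, neg_neg]
  have h' : ⁅⁅x 3, x 9⁆, x 9⁆ = -x 3 := by rw [← lie_skew, h]
  simp only [xSigned, smul_lie, lie_smul, sub_lie, lie_sub, lie_self, h, h', cartanH]
  have : Complex.I * Complex.I = -1 := Complex.I_mul_I
  rw [Units.val_neg]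
  push_cast
  match_scalars
  linear_combination 2 * ((s : ℤ) : ℂ) * Complex.I * this

theorem lie_cartanH_xSigned {k : ℕ} (hk : 1 ≤ k) (hk' : k ≤ 4) (s : ℤˣ) :
    ⁅cartanH x k, xSigned x s⁆ = (if k = 2 then ((s : ℤ) : ℂ) else 0) • xSigned x s := by
  split_ifs with h
  · subst h
    simp only [xSigned, cartanH, smul_lie, lie_smul, lie_sub, hx.up_nine]
    have : Complex.I * Complex.I = -1 := Complex.I_mul_I
    have hs : ((s : ℤ) : ℂ) * ((s : ℤ) : ℂ) = 1 := by exact_mod_cast Int.units_coe_mul_self s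
    match_scalars
    · linear_combination Complex.I * Complex.I * hs
    · linear_combination -((s : ℤ) : ℂ) * Complex.I * this
  · have h9 : ⁅x (2 * k - 1), x 9⁆ = 0 := by
      rw [← lie_skew, hx.far_nine _ (by omega) (by omega) (by omega), neg_zero]
    have h3 : ⁅x (2 * k - 1), x 3⁆ = 0 := by
      rcases lt_or_gt_of_ne h with h | h
      · exact hx.far _ _ (by omega) (by omega) (by omega)
      · exact hx.far' (by omega) (by omega) (by omega)
    simp [xSigned, cartanH, h9, h3, leibniz_lie (x (2 * k - 1)) (x 3)]

theorem lie_cartanH_rootVec (k : Fin 4) (i : Fin 5) (s : ℤˣ) :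
    ⁅cartanH x (k + 1), rootVec x i s⁆ = (((s : ℤ) : ℂ) * rootWeight i k) • rootVec x i s := by
  by_cases hi : i = 0
  · subst hi
    have := hx.lie_cartanH_xSigned (k := k + 1) (by omega) (by omega) s
    rw [show rootVec x 0 s = xSigned x s from rfl, this]
    fin_cases k <;> simp [rootWeight]
  · have key := @lie_wedge_weightVec _ _ _ _ hx
    rw [cartanH_eq x (by omega) (by omega)]
    rcases Int.units_eq_one_or s with rfl | rfl <;> fin_cases i <;> fin_cases k <;>
    first
    | exact absurd rfl hi
    | (simp (disch := decide) [rootVec, rootWeight, key]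
       try rw [wedge_swap]
       try module)

theorem lie_cartanH_cartanH (k l : Fin 4) : ⁅cartanH x (k + 1), cartanH x (l + 1)⁆ = 0 := by
  have key := @lie_wedge_weightVec _ _ _ _ hx
  rw [cartanH_eq x (by omega) (by omega), cartanH_eq x (by omega) (by omega)]
  fin_cases k <;> fin_cases l <;> simp (disch := decide) [key]

theorem lie_rootVec_neg {i : Fin 5} (hi : i ≠ 0) (s : ℤˣ) :
    ⁅rootVec x i s, rootVec x i (-s)⁆ = ((s : ℤ) : ℂ) • soH x i := by
  have key := @lie_wedge_weightVec _ _ _ _ hx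
  have h1 := cartanH_eq x (k := 1) (by norm_num) (by norm_num)
  have h2 := cartanH_eq x (k := 2) (by norm_num) (by norm_num)
  have h3 := cartanH_eq x (k := 3) (by norm_num) (by norm_num)
  have h4 := cartanH_eq x (k := 4) (by norm_num) (by norm_num)
  have sw : ∀ n : ℤ, wedge x (weightVec (-n)) (weightVec n) =
      -wedge x (weightVec n) (weightVec (-n)) := fun n => wedge_swap x _ _
  have hI : Complex.I / 2 * (Complex.I / 2 * 2) = -(1 / 2) := by
    linear_combination (1 / 2 : ℂ) * Complex.I_mul_I
  rcases Int.units_eq_one_or s with rfl | rfl <;> fin_cases i <;>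
  first
  | exact absurd rfl hi
  | (simp (disch := decide) [rootVec, soH, key, h1, h2, h3, h4, wedge_self]
     simp only [sw 1, sw 2, sw 3, sw 4, smul_smul, hI, Complex.I_mul_I]
     module)

end RelationsE9

/-! ### Serre relations with node 0, and the homomorphism -/

namespace RelationsE9

variable {x : ℕ → L} (hx : RelationsE9 x)

include hx

/-- For nodes 1 and 2 the stated signs make the `L_2`-weight of the root vector equal to `s`, so it
is at the end of its string. Nodes 3 and 4 lie in the centralised `so(5)`. -/
theorem lie_xSigned_rootVec_eq_zero {j : Fin 5} (s t : ℤˣ)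
    (hj : j = 1 ∧ t = -s ∨ j = 2 ∧ t = s ∨ j = 3 ∨ j = 4) : ⁅xSigned x s, rootVec x j t⁆ = 0 := by
  rcases hj with ⟨rfl, rfl⟩ | ⟨rfl, rfl⟩ | rfl | rfl
  · change ⁅xSigned x s, (Complex.I / 2) • wedge x _ (weightVec (-((-s : ℤˣ) : ℤ) * 2))⁆ = 0
    rw [Units.val_neg, neg_neg, lie_smul, hx.lie_xSigned_wedge_same _ s, smul_zero]
    rw [mul_one, ← Units.val_neg]
    exact hx.isVector_low _
  · change ⁅xSigned x t, (Complex.I / 2) • wedge x (weightVec (t * 2)) (weightVec (-t * 3))⁆ = 0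
    rw [wedge_swap, smul_neg, lie_neg, lie_smul, ← Units.val_neg,
      hx.lie_xSigned_wedge_same (hx.isVector_high _), smul_zero, neg_zero]
  · change ⁅xSigned x s, (Complex.I / 2) • wedge x (weightVec (t * 3)) (weightVec (-t * 4))⁆ = 0
    rw [lie_smul, hx.lie_xSigned_high, smul_zero] <;>
    rcases Int.units_eq_one_or t with rfl | rfl <;> decide
  · change ⁅xSigned x s, Complex.I • wedge x (weightVec (t * 4)) (weightVec 0)⁆ = 0
    rw [lie_smul, hx.lie_xSigned_high, smul_zero] <;>
    rcases Int.units_eq_one_or t with rfl | rfl <;> decide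

/-- The complementary signs: the root vector has `L_2`-weight `-s`, the opposite end of the string.
-/
theorem exists_rootVec_eq {j : Fin 5} (s t : ℤˣ) (hj : j = 1 ∧ t = s ∨ j = 2 ∧ t = -s) :
    ∃ (c : ℂ) (p : Fin 9 → ℂ), IsVector x p ∧
      rootVec x j t = c • wedge x p (weightVec (-(s : ℤ) * 2)) := by
  rcases hj with ⟨rfl, rfl⟩ | ⟨rfl, rfl⟩
  · refine ⟨Complex.I / 2, _, hx.isVector_low t, ?_⟩
    change (Complex.I / 2) • wedge x (weightVec ((t : ℤ) * 1)) (weightVec (-(t : ℤ) * 2)) = _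
    rw [mul_one]
  · refine ⟨-(Complex.I / 2), _, hx.isVector_high s, ?_⟩
    rw [wedge_swap, smul_neg, neg_smul, neg_neg]
    change (Complex.I / 2) • wedge x (weightVec (_ * 2)) (weightVec (-((-s : ℤˣ) : ℤ) * 3)) = _
    rw [Units.val_neg, neg_neg]

theorem serre (i : Fin 5) (s : ℤˣ) (j : Fin 5) (t : ℤˣ) (hne : ¬ (i = j ∧ s = -t)) :
    ((LieAlgebra.ad ℂ L (rootVec x i s)) ^
      (max 1 (1 - (s : ℤ) * (t : ℤ) * gimB4Diamond i j)).toNat) (rootVec x j t) = 0 := by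
  by_cases hi : i = 0 <;> by_cases hj : j = 0
  · subst hi hj
    have hst : s = t := by
      rcases Int.units_eq_one_or s with rfl | rfl <;> rcases Int.units_eq_one_or t with rfl | rfl <;>
      simp_all
    subst hst
    simp [gimB4Diamond]
  · subst hi
    change ((LieAlgebra.ad ℂ L (xSigned x s)) ^ _) _ = 0
    by_cases h : j = 1 ∧ t = s ∨ j = 2 ∧ t = -s
    · have hn : (max 1 (1 - (s : ℤ) * (t : ℤ) * gimB4Diamond 0 j)).toNat = 3 := by
        rcases Int.units_eq_one_or s with rfl | rfl <;> rcases h with ⟨rfl, rfl⟩ | ⟨rfl, rfl⟩ <;> rfl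
      obtain ⟨c, p, hp, h⟩ := hx.exists_rootVec_eq s t h
      rw [hn, h, map_smul]
      have := hx.lie_xSigned_pow_three hp s
      rw [neg_mul] at this ⊢
      simp [pow_succ, this]
    · have h' : j = 1 ∧ t = -s ∨ j = 2 ∧ t = s ∨ j = 3 ∨ j = 4 := by
        clear hne
        revert h hj j s t; decide
      have hn : (max 1 (1 - (s : ℤ) * (t : ℤ) * gimB4Diamond 0 j)).toNat = 1 := by
        rcases Int.units_eq_one_or s with rfl | rfl <;> rcases Int.units_eq_one_or t with rfl | rfl <;>
        rcases h' with ⟨rfl, h'⟩ | ⟨rfl, h'⟩ | rfl | rfl <;> first | rfl | simp_all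
      rw [hn, pow_one, LieAlgebra.ad_apply, hx.lie_xSigned_rootVec_eq_zero s t h']
  · subst hj
    change ((LieAlgebra.ad ℂ L _) ^ _) (xSigned x t) = 0
    by_cases h : i = 1 ∧ s = t ∨ i = 2 ∧ s = -t
    · have hn : (max 1 (1 - (s : ℤ) * (t : ℤ) * gimB4Diamond i 0)).toNat = 2 := by
        rcases Int.units_eq_one_or t with rfl | rfl <;> rcases h with ⟨rfl, rfl⟩ | ⟨rfl, rfl⟩ <;> rfl
      obtain ⟨c, p, hp, h⟩ := hx.exists_rootVec_eq t s h
      have := hx.lie_wedge_lie_wedge_xSigned hp t (-t)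
      rw [Units.val_neg] at this
      rw [hn, h]
      rw [neg_mul] at this ⊢
      simp [pow_succ, this]
    · have h' : i = 1 ∧ s = -t ∨ i = 2 ∧ s = t ∨ i = 3 ∨ i = 4 := by
        clear hne
        revert h hi i s t; decide
      have hn : (max 1 (1 - (s : ℤ) * (t : ℤ) * gimB4Diamond i 0)).toNat = 1 := by
        rcases Int.units_eq_one_or s with rfl | rfl <;> rcases Int.units_eq_one_or t with rfl | rfl <;>
        rcases h' with ⟨rfl, h'⟩ | ⟨rfl, h'⟩ | rfl | rfl <;> first | rfl | simp_all
      rw [hn, pow_one, LieAlgebra.ad_apply, ← lie_skew, hx.lie_xSigned_rootVec_eq_zero t s h', neg_zero]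
  · exact hx.serre_rootVec hi hj s t hne

/-- The homomorphism to a Lie algebra with Berman generators, with the image of `E_0` rescaled. -/
theorem exists_chevalleyHom {𝔱 : Type*} [AddCommGroup 𝔱] [Module ℂ 𝔱] (B : RootBasis gimB4Diamond 𝔱)
    (c : ℂˣ) : ∃ φ : B.chevalleySubalgebra →ₗ⁅ℂ⁆ L,
      φ (B.chevE 0) = (c : ℂ) • xPlus x ∧ φ (B.chevF 0) = (c⁻¹ : ℂ) • xMinus x ∧
      φ (B.chevH 0) = (2 : ℂ) • cartanH x 2 ∧
      ∀ i : Fin 5, i ≠ 0 →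
        φ (B.chevE i) = soE x i ∧ φ (B.chevF i) = soF x i ∧ φ (B.chevH i) = soH x i := by
  let r := B.root
  -- The functionals `L_1, …, L_4` expressed through the roots. Indices are shifted by one, so `l 1`
  -- is `L_2`.
  let l : Fin 4 → Module.Dual ℂ 𝔱 := ![r 1 + r 2 + r 3 + r 4, r 2 + r 3 + r 4, r 3 + r 4, r 4]
  let η : 𝔱 →ₗ[ℂ] L := ∑ k, (l k).smulRight (cartanH x (k + 1))
  have hη : ∀ h, η h = ∑ k, l k h • cartanH x (k + 1) := fun h => by simp [η]
  have hη_coroot : ∀ i, η (B.coroot i) = if i = 0 then (2 : ℂ) • cartanH x 2 else soH x i := by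
    intro i
    rw [hη]
    fin_cases i <;> simp [Fin.sum_univ_four, l, r, B.root_coroot, gimB4Diamond, soH] <;> norm_num <;>
      module
  -- The correction `α_0 - L_2` vanishes on all coroots and enters only at node 0, which is also the
  -- only node rescaled.
  obtain ⟨φ, hφ⟩ := B.exists_chevalleyHom η (r 0 - l 1) (fun i => if i = 0 then 1 else 0)
    (fun i => if i = 0 then c else 1) (rootVec x)
    (fun h h' => by
      simp [hη, sum_lie, lie_sum, hx.lie_cartanH_cartanH])
    (fun i => by
      fin_cases i <;> simp [l, r, B.root_coroot, gimB4Diamond] <;> norm_num)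
    (fun h i s => by
      rw [hη, sum_lie]
      simp only [smul_lie, hx.lie_cartanH_rootVec, smul_smul, ← Finset.sum_smul]
      congr 1
      fin_cases i <;> simp [Fin.sum_univ_four, l, r, rootWeight] <;> ring)
    (fun i s => by
      rw [hη_coroot]
      split_ifs with h
      · subst h; exact hx.lie_xSigned_xSigned s
      · exact hx.lie_rootVec_neg h s)
    hx.serre
  refine ⟨φ, ?_, ?_, ?_, fun i hi => ⟨?_, ?_, ?_⟩⟩
  · rw [(hφ 0).1, rootVec_zero_one]; rfl
  · rw [(hφ 0).2.1, rootVec_zero_neg_one]; rfl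
  · rw [(hφ 0).2.2, hη_coroot, if_pos rfl]
  · simp [(hφ i).1, hi, rootVec_one]
  · simp [(hφ i).2.1, hi, rootVec_neg_one]
  · rw [(hφ i).2.2, hη_coroot, if_neg hi]

end RelationsE9
-- Generation by the root vectors, and the kernel element
theorem weightVec_induction {p : (Fin 9 → ℂ) → Prop} (hw : ∀ a : ℤ, a.natAbs ≤ 4 → p (weightVec a))
    (hadd : ∀ u v, p u → p v → p (u + v)) (hsmul : ∀ (c : ℂ) u, p u → p (c • u)) (u : Fin 9 → ℂ) :
    p u := by
  have h0 : p 0 := by simpa using hsmul 0 _ (hw 0 (by decide))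
  refine basisVec_induction (fun a ha ha' => ?_) h0 hadd hsmul u
  rcases eq_or_lt_of_le ha' with rfl | ha'
  · rw [← weightVec_zero]; exact hw 0 (by decide)
  · obtain ⟨k, rfl | rfl⟩ : ∃ k, a = 2 * k ∨ a = 2 * k - 1 := ⟨(a + 1) / 2, by omega⟩
    · rw [basisVec_even (by omega)]
      exact hsmul _ _ (hadd _ _ (hw _ (by omega)) (hw _ (by omega)))
    · rw [basisVec_odd (by omega), sub_eq_add_neg, ← neg_one_smul ℂ (weightVec (-_))]
      exact hsmul _ _ (hadd _ _ (hw _ (by omega)) (hsmul _ _ (hw _ (by omega))))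

theorem two_smul_cartanH_two (x : ℕ → L) : (2 : ℂ) • cartanH x 2 =
    (2 : ℂ) • soH x 2 + (2 : ℂ) • soH x 3 + soH x 4 := by
  simp [soH]
  module

namespace RelationsE9

variable {x : ℕ → L} (hx : RelationsE9 x)

include hx

theorem lie_wedge_neg_wedge_zero {a b : ℤ} (ha : a.natAbs ≤ 4) (hb : b.natAbs ≤ 4) (ha0 : a ≠ 0)
    (hb0 : b ≠ 0) (hab : a + b ≠ 0) :
    ⁅wedge x (weightVec a) (weightVec (-b)), wedge x (weightVec b) (weightVec 0)⁆ =
      (2 : ℂ) • wedge x (weightVec a) (weightVec 0) := by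
  rw [hx.lie_wedge_weightVec ha (by omega) hb (by decide)]
  simp [ha0, hb0, hab]

theorem lie_wedge_zero_wedge_zero {a b : ℤ} (ha : a.natAbs ≤ 4) (hb : b.natAbs ≤ 4) (ha0 : a ≠ 0)
    (hb0 : b ≠ 0) :
    ⁅wedge x (weightVec a) (weightVec 0), wedge x (weightVec b) (weightVec 0)⁆ =
      wedge x (weightVec b) (weightVec a) := by
  rw [hx.lie_wedge_weightVec ha (by decide) hb (by decide)]
  simp [ha0, hb0, wedge_self]

section

variable (N : LieSubalgebra ℂ L) (hN : ∀ i s, rootVec x i s ∈ N)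

include hN

/-- Starting from the short root vector at `±L_4`, the long root vectors at `±(L_k - L_{k+1})` move
it to `±L_3`, `±L_2` and `±L_1` in turn. -/
theorem wedge_weightVec_zero_mem {a : ℤ} (ha : a.natAbs ≤ 4) :
    wedge x (weightVec a) (weightVec 0) ∈ N := by
  have scale : ∀ {c : ℂ} {y : L}, c ≠ 0 → c • y ∈ N → y ∈ N := fun {c} {y} hc h => by
    simpa [smul_smul, hc] using N.smul_mem c⁻¹ h
  have hI2 : Complex.I / 2 ≠ 0 := div_ne_zero Complex.I_ne_zero two_ne_zero
  have step : ∀ {a b : ℤ}, a.natAbs ≤ 4 → b.natAbs ≤ 4 → a ≠ 0 → b ≠ 0 → a + b ≠ 0 →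
      wedge x (weightVec a) (weightVec (-b)) ∈ N → wedge x (weightVec b) (weightVec 0) ∈ N →
      wedge x (weightVec a) (weightVec 0) ∈ N := fun ha hb ha0 hb0 hab h h' => by
    have := N.lie_mem h h'
    rw [hx.lie_wedge_neg_wedge_zero ha hb ha0 hb0 hab] at this
    exact scale two_ne_zero this
  rcases weightVec_cases ha with rfl | ⟨s, n, hn, hn', rfl⟩
  · rw [wedge_self]; exact N.zero_mem
  have low : ∀ k : ℕ, 1 ≤ k → k ≤ 3 → wedge x (weightVec (s * k)) (weightVec (-s * (k + 1))) ∈ N →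
      wedge x (weightVec (s * (k + 1))) (weightVec 0) ∈ N →
      wedge x (weightVec (s * k)) (weightVec 0) ∈ N := by
    intro k hk hk' h h'
    rw [neg_mul] at h
    rcases Int.units_eq_one_or s with rfl | rfl <;> simp only [Units.val_neg, Units.val_one] at h h' ⊢ <;>
    exact step (by omega) (by omega) (by omega) (by omega) (by omega) h h'
  have m4 : wedge x (weightVec (s * 4)) (weightVec 0) ∈ N := scale Complex.I_ne_zero (hN 4 s)
  have m3 : wedge x (weightVec (s * 3)) (weightVec 0) ∈ N :=
    low 3 (by decide) (by decide) (scale hI2 (hN 3 s)) m4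
  have m2 : wedge x (weightVec (s * 2)) (weightVec 0) ∈ N :=
    low 2 (by decide) (by decide) (scale hI2 (hN 2 s)) m3
  have m1 : wedge x (weightVec (s * 1)) (weightVec 0) ∈ N :=
    low 1 (by decide) (by decide) (scale hI2 (hN 1 s)) m2
  interval_cases n <;> assumption

theorem wedge_mem (u v : Fin 9 → ℂ) : wedge x u v ∈ N := by
  refine weightVec_induction (p := fun u => wedge x u v ∈ N) (fun a ha => ?_)
    (fun u u' h h' => ?_) (fun c u h => ?_) u
  · refine weightVec_induction (p := fun v => wedge x (weightVec a) v ∈ N) (fun b hb => ?_)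
      (fun v v' h h' => ?_) (fun c v h => ?_) v
    · by_cases ha0 : a = 0
      · rw [ha0, wedge_swap]; exact N.neg_mem (hx.wedge_weightVec_zero_mem N hN hb)
      · by_cases hb0 : b = 0
        · rw [hb0]; exact hx.wedge_weightVec_zero_mem N hN ha
        -- Wedges of two nonzero weights are brackets of short root vectors.
        · rw [← hx.lie_wedge_zero_wedge_zero hb ha hb0 ha0]
          exact N.lie_mem (hx.wedge_weightVec_zero_mem N hN hb)
            (hx.wedge_weightVec_zero_mem N hN ha)
    · rw [map_add]; exact N.add_mem h h'
    · rw [map_smul]; exact N.smul_mem c h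
  · rw [map_add]; exact N.add_mem h h'
  · rw [map_smul]; exact N.smul_mem c h

/-- The elements `x_±`, `e_j`, `f_j` generate the Berman generators. -/
theorem mem_of_rootVec_mem {k : ℕ} (hk : 1 ≤ k) (hk' : k ≤ 9) : x k ∈ N := by
  rcases eq_or_lt_of_le hk' with rfl | hk'
  -- `x_+ + x_- = 2i x_9`.
  · have h := N.add_mem (hN 0 1) (hN 0 (-1))
    have h2 : rootVec x 0 1 + rootVec x 0 (-1) = (2 * Complex.I) • x 9 := by
      rw [rootVec_zero_one, rootVec_zero_neg_one, xPlus, xMinus]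
      module
    rw [h2] at h
    have hc : 2 * Complex.I ≠ 0 := mul_ne_zero two_ne_zero Complex.I_ne_zero
    simpa only [smul_smul, inv_mul_cancel₀ hc, one_smul] using N.smul_mem (2 * Complex.I)⁻¹ h
  · have h := wedge_basisVec_of_lt x hk (Nat.lt_succ_self k) (by omega)
    rw [show k + 1 - 1 - k = 0 by omega] at h
    rw [show x k = _ from h.symm]
    exact hx.wedge_mem N hN _ _

end

/-- From `w_1 ∧ w_2`, brackets inside `so(9)` produce `w_1 ∧ w_0`, then `w_1 ∧ w_{-1} = 2H_1`, a
nonzero multiple of `x_1`. -/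
theorem wedge_one_two_ne_zero (h1 : x 1 ≠ 0) : wedge x (weightVec 1) (weightVec 2) ≠ 0 := by
  intro h
  have h2 : wedge x (weightVec 1) (weightVec 0) = 0 := by
    have := hx.lie_wedge_neg_wedge_zero (a := 1) (b := -2) (by decide) (by decide) (by decide)
      (by decide) (by decide)
    rw [neg_neg, h, zero_lie] at this
    exact (smul_eq_zero.1 this.symm).resolve_left two_ne_zero
  have h3 : wedge x (weightVec 1) (weightVec (-1)) = 0 := by
    have := hx.lie_wedge_zero_wedge_zero (a := -1) (b := 1) (by decide) (by decide) (by decide)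
      (by decide)
    rw [← this, h2, lie_zero]
  have h4 := cartanH_eq x (k := 1) (by decide) (by decide)
  rw [Nat.cast_one, h3, smul_zero, cartanH] at h4
  exact h1 ((smul_eq_zero.1 h4).resolve_left (neg_ne_zero.2 Complex.I_ne_zero))

/-- Two steps of `x_+` carry the bottom of the string through `w_1 ∧ w_{-2}` to its top, `w_1 ∧
w_2`. -/
theorem lie_xPlus_lie_xPlus_soE : ⁅xPlus x, ⁅xPlus x, soE x 1⁆⁆ =
    Complex.I • wedge x (weightVec 1) (weightVec 2) := by
  obtain ⟨hz, haz, -, h⟩ := hx.low_vector 1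
  have hp := h 1
  have hm := h (-1)
  simp only [Units.val_one, Units.val_neg, Int.cast_one, Int.cast_neg, one_mul, neg_mul] at hp hm
  have e1 : soE x 1 = (Complex.I / 2) • wedge x (weightVec 1) (weightVec (-2)) := by
    rw [show soE x 1 = soE x (1 : Fin 5) from rfl, ← rootVec_one x (by decide)]
    simp [rootVec]
  have hv := lie_xSigned_vector hx.up_nine hx.down_nine hz haz 1 (-1)
  have hw := lie_xSigned_lie_lie hx.up_nine hx.down_nine hz haz 1
  simp only [Units.val_one, Int.cast_one, one_mul, neg_mul] at hv hw
  rw [e1, hp, hm, xPlus]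
  simp only [lie_smul, hv, hw]
  module

/-- The same passage made inside `so(9)`: the second factor climbs the vector representation, with
weights `-L_2, -L_3, -L_4, 0, L_4, L_3, L_2`. -/
theorem lie_soE_chain : ⁅soE x 2, ⁅soE x 3, ⁅soE x 4, ⁅soE x 4, ⁅soE x 3, ⁅soE x 2, soE x 1⁆⁆⁆⁆⁆⁆ =
    Complex.I • wedge x (weightVec 1) (weightVec 2) := by
  have key := @lie_wedge_weightVec _ _ _ _ hx
  have e : ∀ i : Fin 5, i ≠ 0 → soE x (i : ℕ) = rootVec x i 1 := fun i hi => (rootVec_one x hi).symm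
  have e1 := e 1 (by decide)
  have e2 := e 2 (by decide)
  have e3 := e 3 (by decide)
  have e4 := e 4 (by decide)
  rw [show soE x 1 = _ from e1, show soE x 2 = _ from e2, show soE x 3 = _ from e3,
    show soE x 4 = _ from e4]
  simp (disch := decide) [rootVec, key, wedge_self]
  simp only [smul_smul]
  rw [← neg_smul]
  congr 1
  have h2 : Complex.I ^ 2 = -1 := Complex.I_sq
  linear_combination (-Complex.I ^ 5 + Complex.I ^ 3 - Complex.I) * h2

end RelationsE9

end Berman

/-! ### The case of `E_9` -/

theorem cartanE9_nonpos (i j : Fin 9) (h : i ≠ j) : cartanE9 i j ≤ 0 := by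
  fin_cases i <;> fin_cases j <;> first | exact absurd rfl h | decide

theorem cartanE9_simplyLaced (i j : Fin 9) (h : i ≠ j) :
    cartanE9 i j = 0 ∧ cartanE9 j i = 0 ∨ cartanE9 i j = -1 := by
  fin_cases i <;> fin_cases j <;> first | exact absurd rfl h | decide

theorem cartanE9_diag (i : Fin 9) : cartanE9 i i = 2 := by
  fin_cases i <;> rfl

namespace RootBasis

variable {𝔥 : Type*} [AddCommGroup 𝔥] [Module ℂ 𝔥] (R : RootBasis cartanE9 𝔥)

theorem relationsE9_bermanE9 : Berman.RelationsE9 (bermanE9 R) where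
  far i j hi hij hj := by
    have hi' : i ≤ 6 := by omega
    apply R.lie_berman_of_eq_zero <;> interval_cases i <;> interval_cases j <;> decide
  up i hi hi' := by
    apply R.lie_lie_berman_of_eq_neg_one cartanE9_nonpos <;> interval_cases i <;> decide
  down i hi hi' := by
    apply R.lie_lie_berman_of_eq_neg_one cartanE9_nonpos <;> interval_cases i <;> decide
  far_nine i hi hi' h3 := by
    apply R.lie_berman_of_eq_zero <;> interval_cases i <;> first | decide | exact absurd rfl h3
  up_nine := by apply R.lie_lie_berman_of_eq_neg_one cartanE9_nonpos <;> decide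
  down_nine := by apply R.lie_lie_berman_of_eq_neg_one cartanE9_nonpos <;> decide

/-- If `e_1 = f_1`, this element has weights 2 and -2 under `h_1`, so it vanishes and so does `h_1 =
[e_1, f_1]`. But `𝔥` embeds and `α_1(h_1) = 2`. -/
theorem bermanE9_one_ne_zero : bermanE9 R 1 ≠ 0 := by
  intro h
  have hef : R.rootGen 0 1 = R.rootGen 0 (-1) := sub_eq_zero.1 (congrArg Subtype.val h)
  have h1 := R.lie_cartan_rootGen (R.coroot 0) 0 1
  have h2 := R.lie_cartan_rootGen (R.coroot 0) 0 (-1)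
  have hA : R.root 0 (R.coroot 0) = 2 := by rw [R.root_coroot]; simp [cartanE9]
  rw [← hef, h1, hA] at h2
  have he : R.rootGen 0 1 = 0 := by
    have h3 : (4 : ℂ) • R.rootGen 0 1 = 0 := by
      rw [← sub_eq_zero, ← sub_smul] at h2
      convert h2 using 2
      norm_num
    exact (smul_eq_zero.1 h3).resolve_left (by norm_num)
  have h4 := R.lie_rootGen_neg 0 1
  rw [he, zero_lie, Units.val_one, Int.cast_one, one_smul] at h4
  have h5 := R.eq_zero_of_cartan_eq_zero cartanE9_simplyLaced cartanE9_diag h4.symm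
  rw [h5, map_zero] at hA
  exact two_ne_zero hA.symm

end RootBasis

end

/-! ### The proposition -/

theorem mainTheorem8
    {𝔥 : Type*} [AddCommGroup 𝔥] [Module ℂ 𝔥]
    (R : RootBasis cartanE9 𝔥) (hR : R.IsMinimalRealization)
    {𝔱 : Type*} [AddCommGroup 𝔱] [Module ℂ 𝔱] [FiniteDimensional ℂ 𝔱]
    (B : RootBasis gimB4Diamond 𝔱) :
    ∃ φ : B.chevalleySubalgebra →ₗ⁅ℂ⁆ R.maximalCompact,
      Function.Surjective φ ∧
      φ (B.chevE 0) = Berman.xPlus (bermanE9 R) ∧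
      φ (B.chevF 0) = Berman.xMinus (bermanE9 R) ∧
      φ (B.chevH 0) = (2 : ℂ) • Berman.cartanH (bermanE9 R) 2 ∧
      (2 : ℂ) • Berman.cartanH (bermanE9 R) 2 =
        (2 : ℂ) • Berman.soH (bermanE9 R) 2 + (2 : ℂ) • Berman.soH (bermanE9 R) 3 + Berman.soH (bermanE9 R) 4 ∧
      (∀ i : Fin 5, i ≠ 0 →
        φ (B.chevE i) = Berman.soE (bermanE9 R) i ∧
        φ (B.chevF i) = Berman.soF (bermanE9 R) i ∧
        φ (B.chevH i) = Berman.soH (bermanE9 R) i) ∧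
      ¬ Function.Injective φ ∧
      ⁅B.chevE 0, ⁅B.chevE 0, B.chevE 1⁆⁆ ≠
        ⁅B.chevE 2, ⁅B.chevE 3, ⁅B.chevE 4, ⁅B.chevE 4, ⁅B.chevE 3, ⁅B.chevE 2, B.chevE 1⁆⁆⁆⁆⁆⁆ ∧
      φ ⁅B.chevE 0, ⁅B.chevE 0, B.chevE 1⁆⁆ =
        φ ⁅B.chevE 2, ⁅B.chevE 3, ⁅B.chevE 4, ⁅B.chevE 4, ⁅B.chevE 3,
          ⁅B.chevE 2, B.chevE 1⁆⁆⁆⁆⁆⁆ := by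
  have hx := R.relationsE9_bermanE9
  -- The scale `c` of `E_0` is kept because two homomorphisms are compared: this side is quadratic
  -- in `c`, whereas the other does not involve `E_0`.
  have apply_lhs : ∀ (φ : B.chevalleySubalgebra →ₗ⁅ℂ⁆ R.maximalCompact) (c : ℂ),
      φ (B.chevE 0) = c • Berman.xPlus (bermanE9 R) →
      (∀ i : Fin 5, i ≠ 0 → φ (B.chevE i) = Berman.soE (bermanE9 R) i) →
      φ ⁅B.chevE 0, ⁅B.chevE 0, B.chevE 1⁆⁆ = (c * c * Complex.I) •
        Berman.wedge (bermanE9 R) (Berman.weightVec 1) (Berman.weightVec 2) := by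
    intro φ c h0 h
    have h1 : φ (B.chevE 1) = Berman.soE (bermanE9 R) 1 := h 1 (by decide)
    rw [LieHom.map_lie, LieHom.map_lie, h0, h1, smul_lie, smul_lie, lie_smul,
      hx.lie_xPlus_lie_xPlus_soE, smul_smul, smul_smul, mul_assoc]
  have apply_rhs : ∀ (φ : B.chevalleySubalgebra →ₗ⁅ℂ⁆ R.maximalCompact),
      (∀ i : Fin 5, i ≠ 0 → φ (B.chevE i) = Berman.soE (bermanE9 R) i) →
      φ ⁅B.chevE 2, ⁅B.chevE 3, ⁅B.chevE 4, ⁅B.chevE 4, ⁅B.chevE 3,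
        ⁅B.chevE 2, B.chevE 1⁆⁆⁆⁆⁆⁆ = Complex.I •
        Berman.wedge (bermanE9 R) (Berman.weightVec 1) (Berman.weightVec 2) := by
    intro φ h
    have h1 : φ (B.chevE 1) = Berman.soE (bermanE9 R) 1 := h 1 (by decide)
    have h2 : φ (B.chevE 2) = Berman.soE (bermanE9 R) 2 := h 2 (by decide)
    have h3 : φ (B.chevE 3) = Berman.soE (bermanE9 R) 3 := h 3 (by decide)
    have h4 : φ (B.chevE 4) = Berman.soE (bermanE9 R) 4 := h 4 (by decide)
    simp only [LieHom.map_lie, h1, h2, h3, h4]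
    exact hx.lie_soE_chain
  obtain ⟨φ, h0, hF0, hH0, h⟩ := hx.exists_chevalleyHom B 1
  -- Any `c` with `c² ≠ 1` would do. For `c = 2` the two terms map to `4i w_1 ∧ w_2` and `i w_1 ∧
  -- w_2`, so they differ in the source.
  obtain ⟨ψ, g0, -, -, g⟩ := hx.exists_chevalleyHom B (Units.mk0 2 two_ne_zero)
  have hker := (apply_lhs φ 1 h0 fun i hi => (h i hi).1).trans
    (((apply_rhs φ fun i hi => (h i hi).1).trans (by rw [one_mul, one_mul])).symm)
  have hne : ⁅B.chevE 0, ⁅B.chevE 0, B.chevE 1⁆⁆ ≠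
      ⁅B.chevE 2, ⁅B.chevE 3, ⁅B.chevE 4, ⁅B.chevE 4, ⁅B.chevE 3, ⁅B.chevE 2, B.chevE 1⁆⁆⁆⁆⁆⁆ := by
    intro heq
    have h1 := apply_lhs ψ 2 g0 fun i hi => (g i hi).1
    rw [heq, apply_rhs ψ fun i hi => (g i hi).1, ← sub_eq_zero, ← sub_smul] at h1
    have hc : Complex.I - 2 * 2 * Complex.I ≠ 0 := by
      rw [show Complex.I - 2 * 2 * Complex.I = -3 * Complex.I by ring]
      exact mul_ne_zero (by norm_num) Complex.I_ne_zero
    exact hx.wedge_one_two_ne_zero R.bermanE9_one_ne_zero ((smul_eq_zero.1 h1).resolve_left hc)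
  refine ⟨φ, ?_, by simpa using h0, by simpa using hF0, hH0,
    Berman.two_smul_cartanH_two _, h, fun hinj => hne (hinj hker), hne, hker⟩
  have hN : ∀ i s, Berman.rootVec (bermanE9 R) i s ∈ φ.range := by
    intro i s
    rcases Int.units_eq_one_or s with rfl | rfl <;> by_cases hi : i = 0
    · rw [hi, Berman.rootVec_zero_one]; exact ⟨B.chevE 0, by simpa using h0⟩
    · rw [Berman.rootVec_one _ hi]; exact ⟨B.chevE i, (h i hi).1⟩
    · rw [hi, Berman.rootVec_zero_neg_one]; exact ⟨B.chevF 0, by simpa using hF0⟩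
    · rw [Berman.rootVec_neg_one _ hi]; exact ⟨B.chevF i, (h i hi).2.1⟩
  have htop : φ.range = ⊤ := by
    rw [eq_top_iff, ← R.lieSpan_berman cartanE9_nonpos, LieSubalgebra.lieSpan_le]
    rintro _ ⟨i, rfl⟩
    have := hx.mem_of_rootVec_mem φ.range hN (k := i + 1) (by omega) (by omega)
    have hi : bermanE9 R (i + 1) = R.berman i := by simp [bermanE9]
    rwa [hi] at this
  intro y
  have : y ∈ φ.range := htop ▸ LieSubalgebra.mem_top y
  exact this
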